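/- Let $n \ge 1$, let $\Omega \subset \mathbb R^n$ be a bounded domain (non-empty, open, connected), and let $\emptyset \neq \omega \subseteq G$ be domains with $\overline{G} \subset \Omega$. All functions are real-valued. Let $H^2_0(\Omega)$ be the closure of $C_c^\infty(\Omega)$ in $H^2(\Omega)$, normed by $\|v\|_{H^2(\Omega)}^2 = \|v\|_{L_2(\Omega)}^2 + \sum_i \|\partial_i v\|_{L_2(\Omega)}^2 + \sum_{i,j}\|\partial_i\partial_j v\|_{L_2(\Omega)}^2$, and let $H^{-2}(\Omega)$ be its dual. Let $A=(B,C)$ be the bounded linear operator from $L_2(\Omega)$ to $H^{-2}(\Omega) \times L_2(\omega)$ given by $$(Bz)(v) := -\int_\Omega z\, \Delta v\,dx \quad (v \in H^2_0(\Omega)), \qquad Cz := z|_\omega,$$ where $\|(\ell,q)\|_{H^{-2}(\Omega)\times L_2(\omega)} := (\|\ell\|_{H^{-2}(\Omega)}^2 + \|q\|_{L_2(\omega)}^2)^{1/2}$. Call $\alpha \in (0,1]$ a propagation-of-smallness exponent if there is a constant $M$, independent of $w$, such that $$\|w\|_{L_2(G)} \le M\, \|w\|_{L_2(\omega)}^{\alpha}\,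 \|w\|_{L_2(\Omega)}^{1-\alpha} \quad \text{for all harmonic } w \in L_2(\Omega).$$ Then a propagation-of-smallness exponent $\alpha \in (0,1)$ exists, and for every propagation-of-smallness exponent $\alpha \in (0,1]$ there is a constant $M'$, independent of $z$, such that $$\|z\|_{L_2(G)} \le M'\, \|Az\|_{H^{-2}(\Omega)\times L_2(\omega)}^{\alpha} \big(\|z\|_{L_2(\Omega)} + \|Az\|_{H^{-2}(\Omega)\times L_2(\omega)}\big)^{1-\alpha} \quad \text{for all } z \in L_2(\Omega).$$ -/

import Mathlib

open MeasureTheory TopologicalSpace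
open scoped Distributions LineDeriv

noncomputable section

namespace UltraWeak

/-- The Lebesgue space `L₂(U)` of real-valued functions on an open set `U ⊆ ℝⁿ`. -/
abbrev L2 {n : ℕ} (U : Opens (EuclideanSpace ℝ (Fin n))) : Type :=
  Lp ℝ 2 (volume.restrict (U : Set (EuclideanSpace ℝ (Fin n))))

variable {n : ℕ}

/-- The `i`-th standard basis vector of `ℝⁿ`. -/
abbrev basisVec (i : Fin n) : EuclideanSpace ℝ (Fin n) := EuclideanSpace.single i 1

/-- Restriction of functions, `L₂(U) → L₂(V)` for open sets `V ⊆ U`. -/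
def restrictL2 {U V : Opens (EuclideanSpace ℝ (Fin n))} (h : V ≤ U) : L2 U →L[ℝ] L2 V :=
  LinearMap.mkContinuous
    { toFun := fun z => ((Lp.memLp z).mono_measure (Measure.restrict_mono_set volume h)).toLp z
      map_add' := fun z w => by
        rw [← MemLp.toLp_add]
        exact MemLp.toLp_congr _ _ (ae_mono (Measure.restrict_mono_set volume h)
          (Lp.coeFn_add z w))
      map_smul' := fun c z => by
        rw [RingHom.id_apply, ← MemLp.toLp_const_smul]
        exact MemLp.toLp_congr _ _ (ae_mono (Measure.restrict_mono_set volume h)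
          (Lp.coeFn_smul c z)) }
    1 (fun z => by
      rw [one_mul]
      refine (Lp.norm_toLp z ((Lp.memLp z).mono_measure
        (Measure.restrict_mono_set volume h))).trans_le ?_
      rw [Lp.norm_def]
      exact ENNReal.toReal_mono (Lp.memLp z).eLpNorm_ne_top
        (eLpNorm_mono_measure _ (Measure.restrict_mono_set volume h)))

/-- `restrictL2 h z` is (almost everywhere on `V`) the same function as `z`. -/
theorem restrictL2_ae_eq {U V : Opens (EuclideanSpace ℝ (Fin n))} (h : V ≤ U) (z : L2 U) :
    restrictL2 h z =ᵐ[volume.restrict (V : Set (EuclideanSpace ℝ (Fin n)))] z :=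
  MemLp.coeFn_toLp ((Lp.memLp z).mono_measure (Measure.restrict_mono_set volume h))

/-- `g` is the weak partial derivative `∂ᵢu` on `U`:
`∫_U u ∂ᵢφ = -∫_U g φ` for all smooth `φ` with compact support in `U`. -/
def IsWeakDeriv (U : Opens (EuclideanSpace ℝ (Fin n))) (i : Fin n) (u g : L2 U) : Prop :=
  ∀ φ : 𝓓(U, ℝ),
    ∫ x in (U : Set (EuclideanSpace ℝ (Fin n))), u x * (∂_{basisVec i} φ) x
      = -∫ x in (U : Set (EuclideanSpace ℝ (Fin n))), g x * φ x

theorem testFunction_memLp (U : Opens (EuclideanSpace ℝ (Fin n))) (φ : 𝓓(U, ℝ)) :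
    MemLp φ 2 (volume.restrict (U : Set (EuclideanSpace ℝ (Fin n)))) :=
  φ.continuous.memLp_of_hasCompactSupport φ.hasCompactSupport

/-- The inclusion of the test functions on `U` into `L₂(U)`. -/
def testToL2 (U : Opens (EuclideanSpace ℝ (Fin n))) : 𝓓(U, ℝ) →ₗ[ℝ] L2 U where
  toFun φ := (testFunction_memLp U φ).toLp φ
  map_add' φ ψ := MemLp.toLp_add (testFunction_memLp U φ) (testFunction_memLp U ψ)
  map_smul' c φ := MemLp.toLp_const_smul c (testFunction_memLp U φ)

theorem testToL2_ae_eq (U : Opens (EuclideanSpace ℝ (Fin n))) (φ : 𝓓(U, ℝ)) :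
    testToL2 U φ =ᵐ[volume.restrict (U : Set (EuclideanSpace ℝ (Fin n)))] φ :=
  MemLp.coeFn_toLp (testFunction_memLp U φ)

theorem isWeakDeriv_testToL2 (U : Opens (EuclideanSpace ℝ (Fin n))) (i : Fin n)
    (ψ : 𝓓(U, ℝ)) :
    IsWeakDeriv U i (testToL2 U ψ) (testToL2 U (∂_{basisVec i} ψ)) := by
  intro φ
  have key : ∀ (f g : 𝓓(U, ℝ)), ∫ x in (U : Set (EuclideanSpace ℝ (Fin n))),
      testToL2 U f x * g x = ∫ x, f x * g x := by
    intro f g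
    refine (integral_congr_ae ((testToL2_ae_eq U f).mul
      (Filter.EventuallyEq.refl _ (g : _ → ℝ)))).trans ?_
    refine setIntegral_eq_integral_of_forall_compl_eq_zero fun x hx => ?_
    have : g x = 0 := image_eq_zero_of_notMem_tsupport fun h => hx (g.tsupport_subset h)
    simp [this]
  have hint : ∀ f g : 𝓓(U, ℝ), Integrable (fun x => f x * g x) volume := fun f g =>
    (f.continuous.mul g.continuous).integrable_of_hasCompactSupport
      (f.hasCompactSupport.mul_right)
  have hd : ∀ f : 𝓓(U, ℝ), Differentiable ℝ f := fun f =>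
    f.contDiff.differentiable (by simp)
  have hfd : ∀ (f : 𝓓(U, ℝ)) x, (∂_{basisVec i} f) x = fderiv ℝ f x (basisVec i) := by
    intro f x
    rw [← (hd f x).lineDeriv_eq_fderiv]
    exact TestFunction.lineDerivCLM_apply_of_le (by simp)
  rw [key, key]
  have := integral_mul_fderiv_eq_neg_fderiv_mul_of_integrable (𝕜 := ℝ) (f := ψ) (g := φ)
    (v := basisVec i) (μ := volume)
    (by simpa only [hfd] using hint (∂_{basisVec i} ψ) φ)
    (by simpa only [hfd] using hint ψ (∂_{basisVec i} φ)) (hint ψ φ)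
    (fun x _ => hd ψ x) (fun x _ => hd φ x)
  simpa only [hfd] using this

/-- Index set of the components `u`, `∂ᵢu`, `∂ⱼ∂ᵢu` of a 2-jet on `ℝⁿ`. -/
abbrev JetIndex (n : ℕ) : Type := Unit ⊕ Fin n ⊕ (Fin n × Fin n)

/-- The index of the function itself. -/
abbrev idx0 : JetIndex n := Sum.inl ()

/-- The index of the first derivative `∂ᵢu`. -/
abbrev idx1 (i : Fin n) : JetIndex n := Sum.inr (Sum.inl i)

/-- The index of the second derivative `∂ⱼ∂ᵢu`. -/
abbrev idx2 (i j : Fin n) : JetIndex n := Sum.inr (Sum.inr (i, j))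

/-- Families of `L₂(U)`-functions indexed by `JetIndex n`, with the norm
`(∑ₖ ‖Jₖ‖²_{L₂(U)})^{1/2}`. -/
abbrev L2Jet (U : Opens (EuclideanSpace ℝ (Fin n))) : Type :=
  PiLp 2 (fun _ : JetIndex n => L2 U)

theorem integrable_mul_testFunction (U : Opens (EuclideanSpace ℝ (Fin n))) (u : L2 U)
    (φ : 𝓓(U, ℝ)) :
    Integrable (fun x => u x * φ x) (volume.restrict (U : Set (EuclideanSpace ℝ (Fin n)))) :=
  (Lp.memLp u).integrable_mul (testFunction_memLp U φ)

theorem IsWeakDeriv.zero (U : Opens (EuclideanSpace ℝ (Fin n))) (i : Fin n) :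
    IsWeakDeriv U i 0 0 := by
  intro φ
  have h0 : ∀ g : 𝓓(U, ℝ), ∫ x in (U : Set (EuclideanSpace ℝ (Fin n))),
      (0 : L2 U) x * g x = 0 := by
    intro g
    refine (integral_congr_ae ((Lp.coeFn_zero ℝ 2 _).mul
      (Filter.EventuallyEq.refl _ (g : _ → ℝ)))).trans ?_
    simp
  rw [h0, h0, neg_zero]

theorem IsWeakDeriv.add {U : Opens (EuclideanSpace ℝ (Fin n))} {i : Fin n} {u u' g g' : L2 U}
    (h : IsWeakDeriv U i u g) (h' : IsWeakDeriv U i u' g') :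
    IsWeakDeriv U i (u + u') (g + g') := by
  intro φ
  have hadd : ∀ (a b : L2 U) (f : 𝓓(U, ℝ)), ∫ x in (U : Set (EuclideanSpace ℝ (Fin n))),
      (a + b : L2 U) x * f x = (∫ x in (U : Set (EuclideanSpace ℝ (Fin n))), a x * f x)
        + ∫ x in (U : Set (EuclideanSpace ℝ (Fin n))), b x * f x := by
    intro a b f
    rw [← integral_add (integrable_mul_testFunction U a f) (integrable_mul_testFunction U b f)]
    refine integral_congr_ae ?_
    filter_upwards [Lp.coeFn_add a b] with x hx
    rw [hx, Pi.add_apply, add_mul]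
  rw [hadd, hadd, h φ, h' φ, neg_add]

theorem IsWeakDeriv.smul {U : Opens (EuclideanSpace ℝ (Fin n))} {i : Fin n} {u g : L2 U}
    (c : ℝ) (h : IsWeakDeriv U i u g) : IsWeakDeriv U i (c • u) (c • g) := by
  intro φ
  have hsmul : ∀ (a : L2 U) (f : 𝓓(U, ℝ)), ∫ x in (U : Set (EuclideanSpace ℝ (Fin n))),
      (c • a : L2 U) x * f x
        = c * ∫ x in (U : Set (EuclideanSpace ℝ (Fin n))), a x * f x := by
    intro a f
    rw [← integral_const_mul]
    refine integral_congr_ae ?_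
    filter_upwards [Lp.coeFn_smul c a] with x hx
    rw [hx, Pi.smul_apply, smul_eq_mul, mul_assoc]
  rw [hsmul, hsmul, h φ, mul_neg]

/-- The Sobolev space `H²(U)`. A function `u ∈ L₂(U)` with weak derivatives of order at most two
in `L₂(U)` is represented by the family `(u, ∂ᵢu, ∂ⱼ∂ᵢu)` (which `u` determines, as weak
derivatives are unique), so that the norm is
`‖u‖²_{H²(U)} = ‖u‖² + ∑ᵢ ‖∂ᵢu‖² + ∑ᵢⱼ ‖∂ⱼ∂ᵢu‖²`. -/
def H2 (U : Opens (EuclideanSpace ℝ (Fin n))) : Submodule ℝ (L2Jet U) where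
  carrier := {J | (∀ i, IsWeakDeriv U i (J idx0) (J (idx1 i))) ∧
    ∀ i j, IsWeakDeriv U j (J (idx1 i)) (J (idx2 i j))}
  zero_mem' := ⟨fun i => IsWeakDeriv.zero U i, fun _ j => IsWeakDeriv.zero U j⟩
  add_mem' h h' := ⟨fun i => (h.1 i).add (h'.1 i), fun i j => (h.2 i j).add (h'.2 i j)⟩
  smul_mem' c _ h := ⟨fun i => (h.1 i).smul c, fun i j => (h.2 i j).smul c⟩

/-- The inclusion `𝓓(U) → H²(U)` of the test functions, `φ ↦ (φ, ∂ᵢφ, ∂ⱼ∂ᵢφ)`. -/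
def testToH2 (U : Opens (EuclideanSpace ℝ (Fin n))) : 𝓓(U, ℝ) →ₗ[ℝ] H2 U where
  toFun φ := ⟨WithLp.toLp 2 (Sum.elim (fun _ => testToL2 U φ)
      (Sum.elim (fun i => testToL2 U (∂_{basisVec i} φ))
        (fun p => testToL2 U (∂_{basisVec p.2} (∂_{basisVec p.1} φ))))),
    fun i => isWeakDeriv_testToL2 U i φ, fun i j => isWeakDeriv_testToL2 U j (∂_{basisVec i} φ)⟩
  map_add' φ ψ := by
    ext1
    refine PiLp.ext ?_
    rintro (_ | i | p)
    · exact map_add (testToL2 U) φ ψ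
    · exact (congrArg (testToL2 U) (LineDeriv.lineDerivOp_add _ φ ψ)).trans (map_add _ _ _)
    · exact (congrArg (testToL2 U) ((congrArg _ (LineDeriv.lineDerivOp_add _ φ ψ)).trans
        (LineDeriv.lineDerivOp_add _ _ _))).trans (map_add _ _ _)
  map_smul' c φ := by
    ext1
    refine PiLp.ext ?_
    rintro (_ | i | p)
    · exact map_smul (testToL2 U) c φ
    · exact (congrArg (testToL2 U) (LineDeriv.lineDerivOp_smul _ c φ)).trans (map_smul _ _ _)
    · exact (congrArg (testToL2 U) ((congrArg _ (LineDeriv.lineDerivOp_smul _ c φ)).trans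
        (LineDeriv.lineDerivOp_smul _ _ _))).trans (map_smul _ _ _)

/-- The space `H²₀(U)`: the closure of the test functions on `U` in `H²(U)`. -/
def H20 (U : Opens (EuclideanSpace ℝ (Fin n))) : Submodule ℝ (H2 U) :=
  (LinearMap.range (testToH2 U)).topologicalClosure

instance instAddCommGroupH20 (U : Opens (EuclideanSpace ℝ (Fin n))) : AddCommGroup (H20 U) :=
  (H20 U).addCommGroup

instance instNormedAddCommGroupH20 (U : Opens (EuclideanSpace ℝ (Fin n))) :
    NormedAddCommGroup (H20 U) :=
  (H20 U).normedAddCommGroup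

instance instSeminormedAddCommGroupH20 (U : Opens (EuclideanSpace ℝ (Fin n))) :
    SeminormedAddCommGroup (H20 U) :=
  (instNormedAddCommGroupH20 U).toSeminormedAddCommGroup

instance instInnerProductSpaceH20 (U : Opens (EuclideanSpace ℝ (Fin n))) :
    InnerProductSpace ℝ (H20 U) :=
  (H20 U).innerProductSpace

instance instNormedSpaceH20 (U : Opens (EuclideanSpace ℝ (Fin n))) :
    NormedSpace ℝ (H20 U) :=
  (instInnerProductSpaceH20 U).toNormedSpace

/-- The space `H⁻²(U)`: the dual of `H²₀(U)`, with the dual norm. -/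
abbrev Hneg2 (U : Opens (EuclideanSpace ℝ (Fin n))) : Type := StrongDual ℝ (H20 U)

/-- The Laplacian `Δ : H²₀(U) → L₂(U)`, `v ↦ ∑ᵢ ∂ᵢ∂ᵢv`. -/
def laplacian (U : Opens (EuclideanSpace ℝ (Fin n))) : H20 U →L[ℝ] L2 U :=
  (∑ i : Fin n, PiLp.proj 2 (fun _ : JetIndex n => L2 U) (idx2 i i)) ∘L
    (H2 U).subtypeL ∘L (H20 U).subtypeL

/-- The operator `B : L₂(U) → H⁻²(U)`, `(B z)(v) = -∫_U z Δv` for `v ∈ H²₀(U)`, written through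
the inner product of `L₂(U)`; see `opB_apply`. -/
def opB (U : Opens (EuclideanSpace ℝ (Fin n))) : L2 U →L[ℝ] Hneg2 U :=
  -(((laplacian U).precomp ℝ) ∘L innerSL ℝ)

theorem opB_apply (U : Opens (EuclideanSpace ℝ (Fin n))) (z : L2 U) (v : H20 U) :
    opB U z v = -∫ x in (U : Set (EuclideanSpace ℝ (Fin n))), z x * laplacian U v x := by
  have : opB U z v = -inner ℝ z (laplacian U v) := rfl
  rw [this, MeasureTheory.L2.inner_def]
  congr 2
  ext x
  simp [mul_comm]

/-- The operator `A = (B, C) : L₂(U) → H⁻²(U) × L₂(V)`, where `C z = z|_V`; the product carries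
the norm `‖(ℓ, q)‖ = (‖ℓ‖² + ‖q‖²)^{1/2}`. -/
def opA {U V : Opens (EuclideanSpace ℝ (Fin n))} (h : V ≤ U) :
    L2 U →L[ℝ] WithLp 2 (Hneg2 U × L2 V) :=
  (WithLp.prodContinuousLinearEquiv 2 ℝ (Hneg2 U) (L2 V)).symm.toContinuousLinearMap ∘L
    (opB U).prod (restrictL2 h)

/-- `w ∈ L₂(U)` is harmonic: it agrees almost everywhere on `U` with a function that is harmonic
in the classical sense on `U`. -/
def IsHarmonic (U : Opens (EuclideanSpace ℝ (Fin n))) (w : L2 U) : Prop :=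
  ∃ f : EuclideanSpace ℝ (Fin n) → ℝ,
    InnerProductSpace.HarmonicOnNhd f (U : Set (EuclideanSpace ℝ (Fin n))) ∧
      w =ᵐ[volume.restrict (U : Set (EuclideanSpace ℝ (Fin n)))] f

/-- `α` is a propagation-of-smallness exponent for `ω ⊆ G ⊆ Ω`: with some constant `M`,
`‖w‖_{L₂(G)} ≤ M ‖w‖_{L₂(ω)}^α ‖w‖_{L₂(Ω)}^{1-α}` for all harmonic `w ∈ L₂(Ω)`. -/
def IsSmallnessExponent {Ω G ω : Opens (EuclideanSpace ℝ (Fin n))} (hωG : ω ≤ G) (hGΩ : G ≤ Ω)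
    (α : ℝ) : Prop :=
  ∃ M : ℝ, ∀ w : L2 Ω, IsHarmonic Ω w →
    ‖restrictL2 hGΩ w‖ ≤ M * (‖restrictL2 (hωG.trans hGΩ) w‖ ^ α * ‖w‖ ^ (1 - α))

end UltraWeak

end

/-! Both assertions rest on Weyl's lemma in mean value form: an integrable function that annihilates
the Laplacians of all test functions on `U` agrees almost everywhere on `U` with a smooth harmonic
function reproduced by radial mollification (`WeaklyHarmonicOn.exists_ae_eq`). The reason is that
the radius-derivative of the mollifier is the Laplacian of a compactly supported smooth function
(`hasDerivAt_moll`). Mollified values therefore do not depend on the radius, and Lebesgue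
differentiation identifies them with the function.

Existence of an exponent: the mean value formula passes to derivatives and bounds the k-th
directional derivative by `k! (C/R)^k` times the sup over a ball of radius `R`. Taylor coefficients
at a centre are thus controlled both by the sup over a small ball and by the sup over a large one;
interpolating term by term and summing gives a three balls inequality (`exists_three_balls`). Its
dilation factor does not depend on the small radius, so the set of points near which smallness
propagates is open and relatively closed in the connected `Ω`. Compactness of the closure of `G`
then gives one exponent for all of `G`.

Stability: integration by parts and Poincaré's inequality give `‖v‖ ≤ C ‖Δv‖` on `H²₀`
(`exists_norm_le_mul_norm_laplacian`). Let `e` be the orthogonal projection of `z` onto the closure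
of `Δ(H²₀)`. Then `z - e` is harmonic by Weyl's lemma, and duality gives `‖e‖ ≤ C ‖Bz‖`
(`exists_norm_sub_le_opB`). Applying the propagation estimate to `z - e` and absorbing `e` into the
constants finishes the proof, with the same exponent. -/

noncomputable section

namespace UltraWeak

/-! ### Directional derivatives and the coordinate Laplacian -/

section MeanValue

open scoped ContDiff

/-- The directional derivative of `f` in direction `v`. -/
def dd {E : Type*} [NormedAddCommGroup E] [NormedSpace ℝ E] (v : E) (f : E → ℝ) (x : E) : ℝ :=
  fderiv ℝ f x v

section dd

variable {E : Type*} [NormedAddCommGroup E] [NormedSpace ℝ E]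

theorem contDiff_dd {f : E → ℝ} (hf : ContDiff ℝ ∞ f) (v : E) : ContDiff ℝ ∞ (dd v f) :=
  (hf.fderiv_right (m := ∞) (by simp)).clm_apply contDiff_const

theorem contDiffOn_dd {f : E → ℝ} {U : Set E} (hU : IsOpen U) (hf : ContDiffOn ℝ ∞ f U) (v : E) :
    ContDiffOn ℝ ∞ (dd v f) U :=
  (hf.fderiv_of_isOpen hU (m := ∞) (by simp)).clm_apply contDiffOn_const

theorem tsupport_dd_subset (f : E → ℝ) (v : E) : tsupport (dd v f) ⊆ tsupport f :=
  tsupport_fderiv_apply_subset ℝ v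

theorem hasCompactSupport_dd {f : E → ℝ} (hf : HasCompactSupport f) (v : E) :
    HasCompactSupport (dd v f) :=
  hf.fderiv_apply ℝ v

theorem dd_comp_sub_left (f : E → ℝ) (v x : E) :
    dd v (fun y => f (x - y)) = fun y => -dd v f (x - y) := by
  funext y
  simp only [dd]
  have h1 : (fun y => f (x - y)) = fun y => (fun z => f (x + z)) (-y) := by
    funext y
    rw [sub_eq_add_neg]
  have h2 := (ContinuousLinearEquiv.neg ℝ (M := E)).comp_right_fderiv
    (f := fun z => f (x + z)) (x := y)
  have h3 : ((fun z => f (x + z)) ∘ (ContinuousLinearEquiv.neg ℝ (M := E))) =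
    fun y => (fun z => f (x + z)) (-y) := rfl
  rw [h1, ← h3, h2, fderiv_comp_add_left, sub_eq_add_neg]
  simp

theorem dd_neg (f : E → ℝ) (v : E) : dd v (fun y => -f y) = fun y => -dd v f y := by
  funext y
  simp only [dd]
  rw [fderiv_fun_neg]
  simp

theorem dd_dd_comp_sub_left (f : E → ℝ) (v x : E) :
    dd v (dd v (fun y => f (x - y))) = fun y => dd v (dd v f) (x - y) := by
  rw [dd_comp_sub_left, dd_neg, dd_comp_sub_left]
  simp

theorem dd_congr_of_eqOn {f g : E → ℝ} {U : Set E} (hU : IsOpen U) (h : Set.EqOn f g U) (v : E) :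
    Set.EqOn (dd v f) (dd v g) U := fun x hx => by
  simp only [dd]
  rw [(h.eventuallyEq_of_mem (hU.mem_nhds hx)).fderiv_eq]

end dd

variable {n : ℕ}

/-- The Laplacian of a function on `ℝⁿ`, as the sum of the pure second directional derivatives. -/
def lap (f : EuclideanSpace ℝ (Fin n) → ℝ) (x : EuclideanSpace ℝ (Fin n)) : ℝ :=
  ∑ i : Fin n, dd (basisVec i) (dd (basisVec i) f) x

theorem lap_comp_sub_left (f : EuclideanSpace ℝ (Fin n) → ℝ) (x y : EuclideanSpace ℝ (Fin n)) :
    lap (fun y => f (x - y)) y = lap f (x - y) := by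
  simp only [lap, dd_dd_comp_sub_left]

theorem continuous_lap {f : EuclideanSpace ℝ (Fin n) → ℝ} (hf : ContDiff ℝ ∞ f) :
    Continuous (lap f) :=
  continuous_finsetSum _ fun _ _ => (contDiff_dd (contDiff_dd hf _) _).continuous

/-! ### Radial cutoffs and mollifiers -/

/-- A smooth cutoff on the real line, positive on `(-∞, 1)` and zero on `[1, ∞)`. -/
def cutoff (s : ℝ) : ℝ := Real.smoothTransition (1 - s)

theorem contDiff_cutoff : ContDiff ℝ ∞ cutoff :=
  Real.smoothTransition.contDiff.comp (contDiff_const.sub contDiff_id)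

theorem cutoff_nonneg (s : ℝ) : 0 ≤ cutoff s := Real.smoothTransition.nonneg _

theorem cutoff_le_one (s : ℝ) : cutoff s ≤ 1 := Real.smoothTransition.le_one _

theorem cutoff_of_one_le {s : ℝ} (hs : 1 ≤ s) : cutoff s = 0 :=
  Real.smoothTransition.zero_of_nonpos (by linarith)

theorem cutoff_zero : cutoff 0 = 1 := by simp [cutoff]

/-- Half of the antiderivative of `-cutoff` that vanishes on `[1, ∞)`. -/
def cutoffPrim (s : ℝ) : ℝ := -(1 / 2) * ∫ u in (1 : ℝ)..s, cutoff u

theorem hasDerivAt_cutoffPrim (s : ℝ) : HasDerivAt cutoffPrim (-(1 / 2) * cutoff s) s :=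
  (intervalIntegral.integral_hasDerivAt_right
    (contDiff_cutoff.continuous.intervalIntegrable _ _)
    (contDiff_cutoff.continuous.stronglyMeasurableAtFilter _ _)
    contDiff_cutoff.continuous.continuousAt).const_mul _

theorem contDiff_cutoffPrim : ContDiff ℝ ∞ cutoffPrim := by
  rw [contDiff_infty_iff_deriv]
  refine ⟨fun s => (hasDerivAt_cutoffPrim s).differentiableAt, ?_⟩
  have : deriv cutoffPrim = fun s => -(1 / 2) * cutoff s :=
    funext fun s => (hasDerivAt_cutoffPrim s).deriv
  rw [this]
  exact contDiff_const.mul contDiff_cutoff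

theorem cutoffPrim_of_one_le {s : ℝ} (hs : 1 ≤ s) : cutoffPrim s = 0 := by
  have : ∫ u in (1 : ℝ)..s, cutoff u = ∫ u in (1 : ℝ)..s, (0 : ℝ) := by
    refine intervalIntegral.integral_congr fun u hu => ?_
    rw [Set.uIcc_of_le hs] at hu
    exact cutoff_of_one_le hu.1
  rw [cutoffPrim, this]
  simp

/-- The right derivative alone determines the derivative. This covers `s = 1`, where `cutoff`
vanishes only to the right. -/
theorem deriv_cutoff_of_one_le {s : ℝ} (hs : 1 ≤ s) : deriv cutoff s = 0 := by
  have h1 : HasDerivWithinAt cutoff (deriv cutoff s) (Set.Ici s) s :=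
    ((contDiff_cutoff.differentiable (by simp)) s).hasDerivAt.hasDerivWithinAt
  have h2 : HasDerivWithinAt cutoff 0 (Set.Ici s) s :=
    (hasDerivWithinAt_const s (Set.Ici s) (0 : ℝ)).congr
      (fun x hx => cutoff_of_one_le (hs.trans hx)) (cutoff_of_one_le hs)
  exact (uniqueDiffOn_Ici s s Set.self_mem_Ici).eq_deriv _ h1 h2

/-- The radial function `x ↦ g (‖x‖² / t²)`. -/
def radial (g : ℝ → ℝ) (t : ℝ) (x : EuclideanSpace ℝ (Fin n)) : ℝ := g (‖x‖ ^ 2 / t ^ 2)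

theorem contDiff_radial {g : ℝ → ℝ} (hg : ContDiff ℝ ∞ g) (t : ℝ) :
    ContDiff ℝ ∞ (radial (n := n) g t) :=
  hg.comp ((contDiff_norm_sq ℝ).div_const _)

theorem radial_eq_zero {g : ℝ → ℝ} (hg : ∀ s, 1 ≤ s → g s = 0) {t : ℝ} (ht : 0 < t)
    {x : EuclideanSpace ℝ (Fin n)} (hx : t ≤ ‖x‖) : radial g t x = 0 :=
  hg _ (by rw [le_div_iff₀ (by positivity), one_mul]; gcongr)

theorem tsupport_subset_closedBall_of_forall {E : Type*} [NormedAddCommGroup E] {f : E → ℝ} {t : ℝ}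
    (h : ∀ x, t ≤ ‖x‖ → f x = 0) : tsupport f ⊆ Metric.closedBall 0 t := by
  refine closure_minimal (fun x hx => ?_) Metric.isClosed_closedBall
  rw [mem_closedBall_zero_iff]
  by_contra hlt
  exact hx (h x (not_le.mp hlt).le)

theorem tsupport_comp_sub_left {E : Type*} [NormedAddCommGroup E] {f : E → ℝ} {t : ℝ}
    (h : ∀ x, t ≤ ‖x‖ → f x = 0) (x : E) :
    tsupport (fun y => f (x - y)) ⊆ Metric.closedBall x t := by
  refine closure_minimal (fun y hy => ?_) Metric.isClosed_closedBall
  rw [Metric.mem_closedBall, dist_comm, dist_eq_norm]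
  by_contra hlt
  exact hy (h _ (not_le.mp hlt).le)

theorem hasFDerivAt_radial {g : ℝ → ℝ} (hg : Differentiable ℝ g) (t : ℝ)
    (x : EuclideanSpace ℝ (Fin n)) :
    HasFDerivAt (radial g t)
      ((deriv g (‖x‖ ^ 2 / t ^ 2) * (2 / t ^ 2)) • innerSL ℝ x) x := by
  have h1 : HasFDerivAt (fun y : EuclideanSpace ℝ (Fin n) => ‖y‖ ^ 2 / t ^ 2)
      ((t ^ 2)⁻¹ • (2 • innerSL ℝ x)) x := by
    simpa [div_eq_mul_inv, mul_comm] using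
      (hasStrictFDerivAt_norm_sq x).hasFDerivAt.mul_const ((t ^ 2)⁻¹)
  refine ((hg _).hasDerivAt.comp_hasFDerivAt x h1).congr_fderiv ?_
  ext v
  simp
  ring

theorem dd_radial {g : ℝ → ℝ} (hg : Differentiable ℝ g) (t : ℝ)
    (v x : EuclideanSpace ℝ (Fin n)) :
    dd v (radial g t) x = deriv g (‖x‖ ^ 2 / t ^ 2) * (2 / t ^ 2) * inner ℝ x v := by
  rw [dd, (hasFDerivAt_radial hg t x).fderiv]
  simp

theorem dd_dd_radial_cutoffPrim (t : ℝ) (v x : EuclideanSpace ℝ (Fin n)) :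
    dd v (dd v (radial cutoffPrim t)) x =
      -(cutoff (‖x‖ ^ 2 / t ^ 2) * (‖v‖ ^ 2 / t ^ 2)
        + deriv cutoff (‖x‖ ^ 2 / t ^ 2) * (2 / t ^ 4) * inner ℝ x v ^ 2) := by
  have h1 : dd v (radial cutoffPrim t) =
      fun x : EuclideanSpace ℝ (Fin n) => radial cutoff t x * (-(1 / t ^ 2) * inner ℝ x v) := by
    funext x
    rw [dd_radial (contDiff_cutoffPrim.differentiable (by simp)), (hasDerivAt_cutoffPrim _).deriv,
      radial]
    ring
  rw [h1, dd]
  have h2 : HasFDerivAt (fun x : EuclideanSpace ℝ (Fin n) => -(1 / t ^ 2) * inner ℝ x v)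
      (-(1 / t ^ 2) • (innerSL ℝ v)) x := by
    have := ((innerSL ℝ v).hasFDerivAt (x := x)).const_mul (-(1 / t ^ 2))
    refine this.congr_of_eventuallyEq (Filter.Eventually.of_forall fun y => ?_)
    simp [real_inner_comm]
  have h3 := (hasFDerivAt_radial (contDiff_cutoff.differentiable (by simp)) t x).mul h2
  erw [h3.fderiv]
  simp [radial, real_inner_comm]
  ring

theorem lap_radial_cutoffPrim (t : ℝ) (x : EuclideanSpace ℝ (Fin n)) :
    lap (radial cutoffPrim t) x =
      -(n * cutoff (‖x‖ ^ 2 / t ^ 2) / t ^ 2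
        + deriv cutoff (‖x‖ ^ 2 / t ^ 2) * (2 / t ^ 4) * ‖x‖ ^ 2) := by
  simp only [lap, dd_dd_radial_cutoffPrim]
  rw [Finset.sum_neg_distrib, Finset.sum_add_distrib, ← Finset.mul_sum, ← Finset.mul_sum]
  have : ∑ i : Fin n, inner ℝ x (basisVec i) ^ 2 = ‖x‖ ^ 2 := by
    rw [EuclideanSpace.norm_sq_eq]
    simp [basisVec, EuclideanSpace.inner_single_right]
  rw [this]
  simp
  ring

/-- The integral of the unscaled radial cutoff. -/
def mass (n : ℕ) : ℝ := ∫ x : EuclideanSpace ℝ (Fin n), radial cutoff 1 x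

theorem continuous_radial_cutoff (t : ℝ) :
    Continuous (radial cutoff t : EuclideanSpace ℝ (Fin n) → ℝ) :=
  (contDiff_radial contDiff_cutoff t).continuous

theorem hasCompactSupport_radial {g : ℝ → ℝ} (hg : ∀ s, 1 ≤ s → g s = 0) {t : ℝ} (ht : 0 < t) :
    HasCompactSupport (radial g t : EuclideanSpace ℝ (Fin n) → ℝ) :=
  (isCompact_closedBall 0 t).of_isClosed_subset (isClosed_tsupport _)
    (tsupport_subset_closedBall_of_forall fun _ hx => radial_eq_zero hg ht hx)

theorem mass_pos : 0 < mass n := by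
  refine (continuous_radial_cutoff 1).integral_pos_of_hasCompactSupport_nonneg_nonzero
    (hasCompactSupport_radial (fun _ => cutoff_of_one_le) one_pos)
    (fun x => cutoff_nonneg _) (x := 0) ?_
  simp [radial, cutoff_zero]

/-- The radial mollifier on `ℝⁿ` of radius `t`. -/
def moll (t : ℝ) (x : EuclideanSpace ℝ (Fin n)) : ℝ :=
  (mass n)⁻¹ * (t ^ n)⁻¹ * radial cutoff t x

theorem contDiff_moll (t : ℝ) : ContDiff ℝ ∞ (moll (n := n) t) :=
  contDiff_const.mul (contDiff_radial contDiff_cutoff t)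

theorem moll_eq_zero {t : ℝ} (ht : 0 < t) {x : EuclideanSpace ℝ (Fin n)} (hx : t ≤ ‖x‖) :
    moll t x = 0 := by
  rw [moll, radial_eq_zero (fun _ => cutoff_of_one_le) ht hx, mul_zero]

theorem hasCompactSupport_moll {t : ℝ} (ht : 0 < t) : HasCompactSupport (moll (n := n) t) :=
  (isCompact_closedBall 0 t).of_isClosed_subset (isClosed_tsupport _)
    (tsupport_subset_closedBall_of_forall fun _ hx => moll_eq_zero ht hx)

theorem norm_moll_le {t : ℝ} (ht : 0 < t) (x : EuclideanSpace ℝ (Fin n)) :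
    ‖moll t x‖ ≤ (mass n)⁻¹ * (t ^ n)⁻¹ := by
  have := mass_pos (n := n)
  rw [moll, norm_mul, Real.norm_of_nonneg (by positivity)]
  refine mul_le_of_le_one_right (by positivity) ?_
  rw [radial, Real.norm_of_nonneg (cutoff_nonneg _)]
  exact cutoff_le_one _

theorem moll_eq_smul {t : ℝ} (ht : 0 < t) (x : EuclideanSpace ℝ (Fin n)) :
    moll t x = (t ^ n)⁻¹ * moll 1 (t⁻¹ • x) := by
  simp only [moll, radial, norm_smul, norm_inv, Real.norm_of_nonneg ht.le]
  rw [mul_pow, inv_pow, div_eq_inv_mul]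
  simp
  ring

theorem integral_moll {t : ℝ} (ht : 0 < t) : ∫ x : EuclideanSpace ℝ (Fin n), moll t x = 1 := by
  have h1 : ∫ x : EuclideanSpace ℝ (Fin n), moll 1 x = 1 := by
    simp only [moll]
    rw [integral_const_mul, ← mass]
    simp [mass_pos.ne']
  simp only [moll_eq_smul ht]
  rw [integral_const_mul, Measure.integral_comp_smul, h1, finrank_euclideanSpace_fin,
    abs_of_nonneg (by positivity)]
  simp [ht.ne']

/-- The key identity, and the purpose of `cutoffPrim`: the gradient of `radial cutoffPrim t` is
`-x/t²` times the cutoff, and the divergence of this field is, up to a power of `t`, the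
radius-derivative of `t⁻ⁿ` times the cutoff. -/
theorem hasDerivAt_moll {t : ℝ} (ht : 0 < t) (z : EuclideanSpace ℝ (Fin n)) :
    HasDerivAt (fun τ => moll τ z)
      ((mass n)⁻¹ * (t * (t ^ n)⁻¹) * lap (radial cutoffPrim t) z) t := by
  have h1 : HasDerivAt (fun τ : ℝ => ‖z‖ ^ 2 / τ ^ 2) (‖z‖ ^ 2 * (-(2 * t) / (t ^ 2) ^ 2)) t := by
    simpa [div_eq_mul_inv] using
      ((hasDerivAt_pow 2 t).inv (by positivity)).const_mul (‖z‖ ^ 2)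
  have h2 : HasDerivAt (fun τ => radial cutoff τ z) _ t :=
    ((contDiff_cutoff.differentiable (by simp)) (‖z‖ ^ 2 / t ^ 2)).hasDerivAt.comp t h1
  have h3 : HasDerivAt (fun τ : ℝ => (mass n)⁻¹ * (τ ^ n)⁻¹) _ t :=
    ((hasDerivAt_pow n t).inv (by positivity)).const_mul ((mass n)⁻¹)
  refine (h3.mul h2).congr_deriv ?_
  rw [lap_radial_cutoffPrim, radial]
  -- The derivative of `τ ^ n` carries the truncated exponent `n - 1`, so `n = 0` is separate.
  rcases n with _ | n
  · simp
    field_simp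
  · simp
    field_simp
    ring

theorem exists_bound_deriv_cutoff : ∃ C, 0 ≤ C ∧ ∀ s, 0 ≤ s → ‖deriv cutoff s * s‖ ≤ C := by
  have hc : Continuous fun s => deriv cutoff s * s :=
    (contDiff_cutoff.continuous_deriv (by simp)).mul continuous_id
  obtain ⟨C, hC⟩ := isCompact_Icc.exists_bound_of_continuousOn (s := Set.Icc (0 : ℝ) 1)
    hc.continuousOn
  refine ⟨C, (norm_nonneg _).trans (hC 0 (by simp)), fun s hs => ?_⟩
  rcases le_total s 1 with h | h
  · exact hC s ⟨hs, h⟩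
  · rw [deriv_cutoff_of_one_le h, zero_mul, norm_zero]
    exact (norm_nonneg _).trans (hC 0 (by simp))

theorem exists_bound_deriv_moll {t : ℝ} (ht : 0 < t) : ∃ C, ∀ τ, t ≤ τ →
    ∀ z : EuclideanSpace ℝ (Fin n),
      ‖(mass n)⁻¹ * (τ * (τ ^ n)⁻¹) * lap (radial cutoffPrim τ) z‖ ≤ C := by
  obtain ⟨C, hC0, hC⟩ := exists_bound_deriv_cutoff
  have hm := mass_pos (n := n)
  -- The prefactor becomes `τ⁻ⁿ τ⁻¹`, which is largest at `τ = t`; `n` bounds the cutoff term and `2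
  -- * C` the term with its derivative.
  refine ⟨(mass n)⁻¹ * ((t ^ n)⁻¹ * t⁻¹) * (n + 2 * C), fun τ hτ z => ?_⟩
  have hτ0 : 0 < τ := ht.trans_le hτ
  have h1 : (mass n)⁻¹ * (τ * (τ ^ n)⁻¹) * lap (radial cutoffPrim τ) z =
      -((mass n)⁻¹ * ((τ ^ n)⁻¹ * τ⁻¹) * (n * cutoff (‖z‖ ^ 2 / τ ^ 2)
        + 2 * (deriv cutoff (‖z‖ ^ 2 / τ ^ 2) * (‖z‖ ^ 2 / τ ^ 2)))) := by
    rw [lap_radial_cutoffPrim]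
    field_simp
  rw [h1, norm_neg, norm_mul, Real.norm_of_nonneg (by positivity)]
  gcongr
  refine (norm_add_le _ _).trans (add_le_add ?_ ?_)
  · rw [Real.norm_of_nonneg (mul_nonneg (by positivity) (cutoff_nonneg _))]
    exact mul_le_of_le_one_right (by positivity) (cutoff_le_one _)
  · rw [norm_mul, Real.norm_ofNat]
    exact mul_le_mul_of_nonneg_left (hC _ (by positivity)) (by norm_num)

/-! ### Weak harmonicity and Weyl's lemma -/

/-- `F` is weakly harmonic on `U`: it annihilates the Laplacians of test functions on `U`. -/
def WeaklyHarmonicOn (F : EuclideanSpace ℝ (Fin n) → ℝ) (U : Set (EuclideanSpace ℝ (Fin n))) :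
    Prop :=
  ∀ φ : EuclideanSpace ℝ (Fin n) → ℝ, ContDiff ℝ ∞ φ → HasCompactSupport φ → tsupport φ ⊆ U →
    ∫ y, F y * lap φ y = 0

theorem WeaklyHarmonicOn.integral_mul_lap_sub {F : EuclideanSpace ℝ (Fin n) → ℝ}
    {U : Set (EuclideanSpace ℝ (Fin n))} (hF : WeaklyHarmonicOn F U)
    {g : EuclideanSpace ℝ (Fin n) → ℝ} (hg : ContDiff ℝ ∞ g) {t : ℝ}
    (hg0 : ∀ x, t ≤ ‖x‖ → g x = 0) {x : EuclideanSpace ℝ (Fin n)}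
    (hx : Metric.closedBall x t ⊆ U) : ∫ y, F y * lap g (x - y) = 0 := by
  simp only [← lap_comp_sub_left]
  have hs := tsupport_comp_sub_left hg0 x
  exact hF _ (hg.comp (contDiff_const.sub contDiff_id))
    ((isCompact_closedBall x t).of_isClosed_subset (isClosed_tsupport _) hs) (hs.trans hx)

/-- Mollified values of a weakly harmonic function do not depend on the radius. -/
theorem WeaklyHarmonicOn.integral_mul_moll_eq {F : EuclideanSpace ℝ (Fin n) → ℝ}
    {U : Set (EuclideanSpace ℝ (Fin n))} (hF : WeaklyHarmonicOn F U) (hFi : Integrable F)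
    {s t : ℝ} (hs : 0 < s) (hst : s ≤ t) {x : EuclideanSpace ℝ (Fin n)}
    (hx : Metric.closedBall x t ⊆ U) :
    ∫ y, F y * moll t (x - y) = ∫ y, F y * moll s (x - y) := by
  have hd : ∀ τ, 0 < τ → Metric.closedBall x τ ⊆ U →
      HasDerivAt (fun τ => ∫ y, F y * moll τ (x - y)) 0 τ := by
    intro τ hτ hU
    -- Radii above `τ / 2` form a neighbourhood of `τ` on which `‖F‖ * C` dominates the
    -- differentiated integrand.
    obtain ⟨C, hC⟩ := exists_bound_deriv_moll (n := n) (half_pos hτ)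
    have hmeas : ∀ g : EuclideanSpace ℝ (Fin n) → ℝ, Continuous g →
        AEStronglyMeasurable (fun y => F y * g (x - y)) := fun g hg =>
      hFi.aestronglyMeasurable.mul (hg.comp (continuous_const.sub continuous_id)).aestronglyMeasurable
    have key := hasDerivAt_integral_of_dominated_loc_of_deriv_le (μ := volume)
      (F := fun τ y => F y * moll τ (x - y))
      (F' := fun τ y => F y * ((mass n)⁻¹ * (τ * (τ ^ n)⁻¹) * lap (radial cutoffPrim τ) (x - y)))
      (bound := fun y => ‖F y‖ * C) (x₀ := τ) (Ioi_mem_nhds (half_lt_self hτ))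
      (Filter.Eventually.of_forall fun τ => hmeas _ (contDiff_moll τ).continuous)
      (hFi.mul_bdd (c := (mass n)⁻¹ * (τ ^ n)⁻¹)
        ((contDiff_moll τ).continuous.comp
          (continuous_const.sub continuous_id)).aestronglyMeasurable
        (Filter.Eventually.of_forall fun y => norm_moll_le hτ _))
      (hmeas (fun z => (mass n)⁻¹ * (τ * (τ ^ n)⁻¹) * lap (radial cutoffPrim τ) z)
        (continuous_const.mul (continuous_lap (contDiff_radial contDiff_cutoffPrim τ))))
      (Filter.Eventually.of_forall fun y τ' hτ' => by
        rw [norm_mul]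
        exact mul_le_mul_of_nonneg_left (hC τ' (le_of_lt hτ') _) (norm_nonneg _))
      (hFi.norm.mul_const C)
      (Filter.Eventually.of_forall fun y τ' hτ' =>
        (hasDerivAt_moll ((half_pos hτ).trans hτ') (x - y)).const_mul (F y))
    refine key.2.congr_deriv ?_
    have h0 := hF.integral_mul_lap_sub (contDiff_radial contDiff_cutoffPrim τ)
      (fun z hz => radial_eq_zero (fun _ => cutoffPrim_of_one_le) hτ hz) hU
    calc _ = ∫ y, ((mass n)⁻¹ * (τ * (τ ^ n)⁻¹)) *
          (F y * lap (radial cutoffPrim τ) (x - y)) := by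
            congr 1
            funext y
            ring
      _ = 0 := by rw [integral_const_mul, h0, mul_zero]
  have hd' : ∀ τ ∈ Set.Icc s t, HasDerivAt (fun τ => ∫ y, F y * moll τ (x - y)) 0 τ :=
    fun τ hτ => hd τ (hs.trans_le hτ.1) ((Metric.closedBall_subset_closedBall hτ.2).trans hx)
  exact constant_of_has_deriv_right_zero
    (fun τ hτ => (hd' τ hτ).continuousAt.continuousWithinAt)
    (fun τ hτ => (hd' τ (Set.Ico_subset_Icc_self hτ)).hasDerivWithinAt) t (Set.right_mem_Icc.2 hst)

/-- The convolution of real functions on `ℝⁿ`. -/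
def conv (F g : EuclideanSpace ℝ (Fin n) → ℝ) (x : EuclideanSpace ℝ (Fin n)) : ℝ :=
  ∫ y, F y * g (x - y)

theorem contDiff_conv {F g : EuclideanSpace ℝ (Fin n) → ℝ} (hF : LocallyIntegrable F)
    (hg : ContDiff ℝ ∞ g) (hgc : HasCompactSupport g) : ContDiff ℝ ∞ (conv F g) :=
  hgc.contDiff_convolution_right (ContinuousLinearMap.mul ℝ ℝ) hF hg

theorem dd_conv {F g : EuclideanSpace ℝ (Fin n) → ℝ} (hF : LocallyIntegrable F)
    (hg : ContDiff ℝ ∞ g) (hgc : HasCompactSupport g) (v : EuclideanSpace ℝ (Fin n)) :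
    dd v (conv F g) = conv F (dd v g) := by
  funext x
  have h := hgc.hasFDerivAt_convolution_right (ContinuousLinearMap.mul ℝ ℝ) hF
    (hg.of_le (by simp)) x
  have h' : HasFDerivAt (conv F g) _ x := h
  rw [dd, h'.fderiv, convolution_precompR_apply _ hF (hgc.fderiv ℝ)
    (hg.continuous_fderiv (by simp))]
  rfl

theorem integrable_mul_comp_sub {F g : EuclideanSpace ℝ (Fin n) → ℝ} (hF : Integrable F)
    (hg : Continuous g) (hgc : HasCompactSupport g) (x : EuclideanSpace ℝ (Fin n)) :
    Integrable fun y => F y * g (x - y) := by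
  obtain ⟨C, hC⟩ := hgc.exists_bound_of_continuous hg
  exact hF.mul_bdd (c := C) (hg.comp (continuous_const.sub continuous_id)).aestronglyMeasurable
    (Filter.Eventually.of_forall fun y => hC _)

theorem lap_conv {F g : EuclideanSpace ℝ (Fin n) → ℝ} (hF : Integrable F)
    (hg : ContDiff ℝ ∞ g) (hgc : HasCompactSupport g) : lap (conv F g) = conv F (lap g) := by
  funext x
  simp only [lap, conv, Finset.mul_sum]
  rw [integral_finsetSum]
  · refine Finset.sum_congr rfl fun i _ => ?_
    rw [dd_conv hF.locallyIntegrable hg hgc, dd_conv hF.locallyIntegrable (contDiff_dd hg _)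
      (hasCompactSupport_dd hgc _)]
    rfl
  · intro i _
    exact integrable_mul_comp_sub hF (contDiff_dd (contDiff_dd hg _) _).continuous
      (hasCompactSupport_dd (hasCompactSupport_dd hgc _) _) x

theorem laplacian_eq_lap {f : EuclideanSpace ℝ (Fin n) → ℝ} {x : EuclideanSpace ℝ (Fin n)}
    (hf : ContDiffAt ℝ 2 f x) : Laplacian.laplacian f x = lap f x := by
  rw [InnerProductSpace.laplacian_eq_iteratedFDeriv_orthonormalBasis f
    (EuclideanSpace.basisFun (Fin n) ℝ)]
  refine Finset.sum_congr rfl fun i _ => ?_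
  have h : DifferentiableAt ℝ (fderiv ℝ f) x :=
    (hf.fderiv_right (m := 1) (by norm_num)).differentiableAt (by norm_num)
  have h2 : dd (basisVec i) (dd (basisVec i) f) x =
      fderiv ℝ (fun y => fderiv ℝ f y (basisVec i)) x (basisVec i) := rfl
  rw [h2, fderiv_clm_apply h (differentiableAt_const _), iteratedFDeriv_two_apply]
  simp

/-- Smooth functions on `U` that reproduce themselves under mollification inside `U`. -/
structure MeanValueOn (u : EuclideanSpace ℝ (Fin n) → ℝ) (U : Set (EuclideanSpace ℝ (Fin n))) :
    Prop where
  contDiffOn : ContDiffOn ℝ ∞ u U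
  eq_integral : ∀ x t, 0 < t → Metric.closedBall x t ⊆ U → u x = ∫ y, u y * moll t (x - y)

/-- Mollifications of a locally integrable function converge to it almost everywhere. -/
theorem ae_tendsto_integral_mul_moll {F : EuclideanSpace ℝ (Fin n) → ℝ}
    (hF : LocallyIntegrable F) :
    ∀ᵐ x, Filter.Tendsto (fun t => ∫ y, F y * moll t (x - y))
      (nhdsWithin 0 (Set.Ioi 0)) (nhds (F x)) := by
  filter_upwards [(Besicovitch.vitaliFamily volume).ae_tendsto_average_norm_sub hF] with x hx
  have h1 := hx.comp (Besicovitch.tendsto_filterAt volume x)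
  -- The kernel has mass one and is bounded by a fixed constant over the volume of its ball, so
  -- convergence at Lebesgue points applies.
  have h2 := tendsto_integral_smul_of_tendsto_average_norm_sub
    (g := fun t y => moll t (x - y))
    ((mass n)⁻¹ * volume.real (Metric.closedBall (0 : EuclideanSpace ℝ (Fin n)) 1)) h1
    (Filter.Eventually.of_forall fun t => hF.integrableOn_isCompact (isCompact_closedBall _ _))
    ?_ ?_ ?_
  · simpa only [smul_eq_mul, mul_comm] using h2
  · refine tendsto_const_nhds.congr' ?_
    filter_upwards [self_mem_nhdsWithin] with t ht
    rw [integral_sub_left_eq_self (fun z => moll t z), integral_moll ht]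
  · filter_upwards [self_mem_nhdsWithin] with t ht y hy
    rw [Metric.mem_closedBall, dist_comm, dist_eq_norm]
    by_contra hlt
    exact hy (moll_eq_zero ht (not_le.mp hlt).le)
  · filter_upwards [self_mem_nhdsWithin] with t ht y
    refine (norm_moll_le ht _).trans (le_of_eq ?_)
    have ht' : (0 : ℝ) < t := ht
    have h0 : volume.real (Metric.closedBall x t) =
        t ^ n * volume.real (Metric.closedBall (0 : EuclideanSpace ℝ (Fin n)) 1) := by
      rw [Measure.addHaar_real_closedBall' _ _ ht'.le]
      simp
    have h3 : 0 < volume.real (Metric.closedBall (0 : EuclideanSpace ℝ (Fin n)) 1) :=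
      ENNReal.toReal_pos (Metric.measure_closedBall_pos volume _ one_pos).ne'
        measure_closedBall_lt_top.ne
    rw [h0]
    field_simp

theorem exists_closedBall_subset {U : Set (EuclideanSpace ℝ (Fin n))} (hU : IsOpen U)
    {x : EuclideanSpace ℝ (Fin n)} (hx : x ∈ U) : ∃ t > 0, Metric.closedBall x t ⊆ U :=
  Metric.nhds_basis_closedBall.mem_iff.1 (hU.mem_nhds hx)

/-- Weyl's lemma. -/
theorem WeaklyHarmonicOn.exists_ae_eq {F : EuclideanSpace ℝ (Fin n) → ℝ}
    {U : Set (EuclideanSpace ℝ (Fin n))} (hU : IsOpen U) (hF : WeaklyHarmonicOn F U)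
    (hFi : Integrable F) :
    ∃ u, MeanValueOn u U ∧ InnerProductSpace.HarmonicOnNhd u U ∧
      F =ᵐ[volume.restrict U] u := by
  choose! r hr0 hr using fun x (hx : x ∈ U) => exists_closedBall_subset hU hx
  -- The radius varies with the point, but the value does not depend on it. Near each point `u` is
  -- therefore a convolution with one fixed kernel, which makes it smooth.
  set u : EuclideanSpace ℝ (Fin n) → ℝ := fun x => conv F (moll (r x)) x with hu
  have hu_eq : ∀ x t, 0 < t → Metric.closedBall x t ⊆ U → u x = conv F (moll t) x := by
    intro x t ht hx
    have hxU : x ∈ U := hx (Metric.mem_closedBall_self ht.le)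
    rcases le_total (r x) t with h | h
    · exact (hF.integral_mul_moll_eq hFi (hr0 x hxU) h hx).symm
    · exact hF.integral_mul_moll_eq hFi ht h (hr x hxU)
  have hloc : ∀ x ∈ U, ∃ δ > 0, ∀ y ∈ Metric.ball x δ,
      Metric.closedBall y δ ⊆ U ∧ u y = conv F (moll δ) y := by
    intro x hx
    refine ⟨r x / 2, half_pos (hr0 x hx), fun y hy => ?_⟩
    have hy' : Metric.closedBall y (r x / 2) ⊆ U := by
      refine (Metric.closedBall_subset_closedBall' ?_).trans (hr x hx)
      have := (Metric.mem_ball.1 hy).le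
      linarith
    exact ⟨hy', hu_eq y _ (half_pos (hr0 x hx)) hy'⟩
  have hsmooth : ∀ t, 0 < t → ContDiff ℝ ∞ (conv F (moll t)) := fun t ht =>
    contDiff_conv hFi.locallyIntegrable (contDiff_moll t) (hasCompactSupport_moll ht)
  have hev : ∀ x ∈ U, ∃ δ > 0, u =ᶠ[nhds x] conv F (moll δ) ∧
      ∀ᶠ y in nhds x, Metric.closedBall y δ ⊆ U := by
    intro x hx
    obtain ⟨δ, hδ, h⟩ := hloc x hx
    exact ⟨δ, hδ, Filter.eventually_of_mem (Metric.ball_mem_nhds x hδ) fun y hy => (h y hy).2,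
      Filter.eventually_of_mem (Metric.ball_mem_nhds x hδ) fun y hy => (h y hy).1⟩
  have hae : F =ᵐ[volume.restrict U] u := by
    rw [Filter.EventuallyEq, ae_restrict_iff' hU.measurableSet]
    filter_upwards [ae_tendsto_integral_mul_moll hFi.locallyIntegrable] with x hx hxU
    refine tendsto_nhds_unique hx (tendsto_const_nhds.congr' ?_)
    filter_upwards [Ioo_mem_nhdsGT (hr0 x hxU)] with t ht
    exact hu_eq x t ht.1 ((Metric.closedBall_subset_closedBall ht.2.le).trans (hr x hxU))
  refine ⟨u, ⟨fun x hx => ?_, fun x t ht hx => ?_⟩, fun x hx => ?_, hae⟩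
  · obtain ⟨δ, hδ, h, -⟩ := hev x hx
    exact ((hsmooth δ hδ).contDiffAt.congr_of_eventuallyEq h).contDiffWithinAt
  · rw [hu_eq x t ht hx]
    refine integral_congr_ae ?_
    rw [Filter.EventuallyEq, ae_restrict_iff' hU.measurableSet] at hae
    filter_upwards [hae] with y hy
    by_cases hyU : y ∈ U
    · rw [hy hyU]
    · rw [moll_eq_zero ht, mul_zero, mul_zero]
      rw [← dist_eq_norm, dist_comm]
      by_contra hlt
      exact hyU (hx (Metric.mem_closedBall.2 (not_le.1 hlt).le))
  · obtain ⟨δ, hδ, h, h'⟩ := hev x hx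
    have hδ2 : ContDiff ℝ 2 (conv F (moll δ)) := (hsmooth δ hδ).of_le ENat.LEInfty.out
    rw [InnerProductSpace.harmonicAt_congr_nhds h]
    refine ⟨hδ2.contDiffAt, ?_⟩
    filter_upwards [h'] with y hy
    -- The Laplacian falls on the mollifier, where weak harmonicity annihilates it.
    rw [laplacian_eq_lap hδ2.contDiffAt, lap_conv hFi (contDiff_moll δ) (hasCompactSupport_moll hδ)]
    exact hF.integral_mul_lap_sub (contDiff_moll δ) (fun z hz => moll_eq_zero hδ hz) hy

/-! ### Interior estimates for derivatives -/

theorem continuous_mul_of_tsupport_subset {E : Type*} [TopologicalSpace E] {a b : E → ℝ} {U : Set E}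
    (hU : IsOpen U) (ha : ContinuousOn a U) (hb : Continuous b) (hbU : tsupport b ⊆ U) :
    Continuous fun x => a x * b x :=
  continuous_of_tsupport fun _ hx => (ha.continuousAt
    (hU.mem_nhds (hbU (tsupport_mul_subset_right hx)))).mul hb.continuousAt

theorem integrable_mul_of_tsupport_subset {a b : EuclideanSpace ℝ (Fin n) → ℝ}
    {U : Set (EuclideanSpace ℝ (Fin n))} (hU : IsOpen U) (ha : ContinuousOn a U)
    (hb : Continuous b) (hbc : HasCompactSupport b) (hbU : tsupport b ⊆ U) :
    Integrable fun x => a x * b x :=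
  (continuous_mul_of_tsupport_subset hU ha hb hbU).integrable_of_hasCompactSupport hbc.mul_left

/-- Integration by parts against a test function supported in `U`. -/
theorem integral_mul_dd {a b : EuclideanSpace ℝ (Fin n) → ℝ}
    {U : Set (EuclideanSpace ℝ (Fin n))} (hU : IsOpen U) (ha : ContDiffOn ℝ 1 a U)
    (hb : ContDiff ℝ ∞ b) (hbc : HasCompactSupport b) (hbU : tsupport b ⊆ U)
    (v : EuclideanSpace ℝ (Fin n)) :
    ∫ x, a x * dd v b x = -∫ x, dd v a x * b x := by
  have ha' : ContinuousOn (dd v a) U :=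
    (ha.continuousOn_fderiv_of_isOpen hU (by simp)).clm_apply continuousOn_const
  exact integral_mul_fderiv_eq_neg_fderiv_mul_of_integrable
    (integrable_mul_of_tsupport_subset hU ha' hb.continuous hbc hbU)
    (integrable_mul_of_tsupport_subset hU ha.continuousOn (contDiff_dd hb v).continuous
      (hasCompactSupport_dd hbc v) ((tsupport_dd_subset b v).trans hbU))
    (integrable_mul_of_tsupport_subset hU ha.continuousOn hb.continuous hbc hbU)
    (fun x hx => (ha.differentiableOn (by simp)).differentiableAt (hU.mem_nhds (hbU hx)))
    (fun x _ => (hb.differentiable (by simp)) x)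

theorem dd_moll_eq_zero {t : ℝ} (ht : 0 < t) (v : EuclideanSpace ℝ (Fin n))
    {z : EuclideanSpace ℝ (Fin n)} (hz : t < ‖z‖) : dd v (moll t) z = 0 := by
  refine image_eq_zero_of_notMem_tsupport fun h => ?_
  have := tsupport_subset_closedBall_of_forall (fun x hx => moll_eq_zero ht hx)
    (tsupport_dd_subset _ v h)
  rw [mem_closedBall_zero_iff] at this
  exact absurd hz (not_lt.2 this)

/-- Differentiation of the mean value formula, with the derivative on the mollifier. -/
theorem MeanValueOn.dd_eq_integral {u : EuclideanSpace ℝ (Fin n) → ℝ}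
    {U : Set (EuclideanSpace ℝ (Fin n))} (hU : IsOpen U) (hu : MeanValueOn u U)
    (v x : EuclideanSpace ℝ (Fin n)) {t : ℝ} (ht : 0 < t) (hx : Metric.closedBall x t ⊆ U) :
    dd v u x = ∫ z, u z * dd v (moll t) (x - z) := by
  -- For `y` within `δ` of `x`, the kernel centred at `y` does not see the complement of the
  -- enlarged ball `K`. There `u` is the convolution of an integrable function with a fixed kernel
  -- and can be differentiated as such.
  obtain ⟨δ, hδ, hδU⟩ := (isCompact_closedBall x t).exists_cthickening_subset_open hU hx
  rw [cthickening_closedBall hδ.le ht.le] at hδU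
  set K := Metric.closedBall x (δ + t)
  have hF : Integrable (K.indicator u) :=
    ((hu.contDiffOn.continuousOn.mono hδU).integrableOn_compact
      (isCompact_closedBall _ _)).integrable_indicator Metric.isClosed_closedBall.measurableSet
  have hrep : ∀ (k : EuclideanSpace ℝ (Fin n) → ℝ), (∀ z, t < ‖z‖ → k z = 0) →
      ∀ y ∈ Metric.ball x δ, conv (K.indicator u) k y = ∫ z, u z * k (y - z) := by
    intro k hk y hy
    refine integral_congr_ae (Filter.Eventually.of_forall fun z => ?_)
    by_cases hz : z ∈ K
    · simp [hz]
    · simp only [Set.indicator_of_notMem hz]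
      rw [hk, mul_zero, mul_zero]
      rw [Metric.mem_closedBall, not_le] at hz
      have h1 := dist_triangle z y x
      rw [← dist_eq_norm, dist_comm]
      have h2 := Metric.mem_ball.1 hy
      linarith
  have heq : Set.EqOn u (conv (K.indicator u) (moll t)) (Metric.ball x δ) := by
    intro y hy
    rw [hrep _ (fun z hz => moll_eq_zero ht hz.le) y hy]
    refine hu.eq_integral y t ht ((Metric.closedBall_subset_closedBall' ?_).trans hδU)
    have := (Metric.mem_ball.1 hy).le
    linarith
  rw [dd_congr_of_eqOn Metric.isOpen_ball heq v (Metric.mem_ball_self hδ),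
    dd_conv hF.locallyIntegrable (contDiff_moll t) (hasCompactSupport_moll ht),
    hrep _ (fun z hz => dd_moll_eq_zero ht v hz) x (Metric.mem_ball_self hδ)]

/-- The derivative of the formula first falls on the mollifier; integration by parts inside `U`
returns it to `u`. This permits iteration of the gradient bound. -/
theorem MeanValueOn.dd {u : EuclideanSpace ℝ (Fin n) → ℝ} {U : Set (EuclideanSpace ℝ (Fin n))}
    (hU : IsOpen U) (hu : MeanValueOn u U) (v : EuclideanSpace ℝ (Fin n)) :
    MeanValueOn (dd v u) U := by
  refine ⟨contDiffOn_dd hU hu.contDiffOn v, fun x t ht hx => ?_⟩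
  have hs := tsupport_comp_sub_left (fun z hz => moll_eq_zero (n := n) ht hz) x
  have h : ∫ z, u z * UltraWeak.dd v (fun z => moll t (x - z)) z =
      -∫ z, UltraWeak.dd v u z * moll t (x - z) := integral_mul_dd hU (hu.contDiffOn.of_le (by simp))
    ((contDiff_moll t).comp (contDiff_const.sub contDiff_id))
    ((isCompact_closedBall x t).of_isClosed_subset (isClosed_tsupport _) hs) (hs.trans hx) v
  rw [hu.dd_eq_integral hU v x ht hx, ← neg_eq_iff_eq_neg.2 h, dd_comp_sub_left,
    ← integral_neg]
  simp

/-- Gradient bound for functions with the mean value property. -/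
theorem exists_norm_dd_le (n : ℕ) : ∃ C : ℝ, 1 ≤ C ∧
    ∀ (u : EuclideanSpace ℝ (Fin n) → ℝ) (U : Set (EuclideanSpace ℝ (Fin n))), IsOpen U →
      MeanValueOn u U → ∀ (v x : EuclideanSpace ℝ (Fin n)) (t S : ℝ), ‖v‖ ≤ 1 → 0 < t →
        Metric.closedBall x t ⊆ U → (∀ y ∈ Metric.closedBall x t, ‖u y‖ ≤ S) →
          ‖dd v u x‖ ≤ C / t * S := by
  have hc : Continuous (fderiv ℝ (moll (n := n) 1)) :=
    (contDiff_moll 1).continuous_fderiv (by simp)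
  have hi : Integrable fun z => ‖fderiv ℝ (moll (n := n) 1) z‖ :=
    (hc.integrable_of_hasCompactSupport ((hasCompactSupport_moll one_pos).fderiv ℝ)).norm
  -- By scaling, the gradient of `moll t` has `L₁` norm `t⁻¹` times that of `moll 1`. The maximum
  -- with 1 keeps later radii proportional to `1 / C` small.
  refine ⟨max 1 (∫ z, ‖fderiv ℝ (moll (n := n) 1) z‖), le_max_left _ _, ?_⟩
  intro u U hU hu v x t S hv ht hx hS
  have hS0 : 0 ≤ S := (norm_nonneg _).trans (hS x (Metric.mem_closedBall_self ht.le))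
  have hdd : ∀ z, dd v (moll t) z = (t ^ n)⁻¹ * (t⁻¹ * fderiv ℝ (moll (n := n) 1) (t⁻¹ • z) v) := by
    intro z
    have h1 : HasFDerivAt (fun z : EuclideanSpace ℝ (Fin n) => t⁻¹ • z)
        (t⁻¹ • ContinuousLinearMap.id ℝ _) z := (hasFDerivAt_id z).const_smul t⁻¹
    have h2 := ((((contDiff_moll (n := n) 1).differentiable (by simp))
      (t⁻¹ • z)).hasFDerivAt.comp z h1).const_mul ((t ^ n)⁻¹)
    have h3 : moll t = fun z : EuclideanSpace ℝ (Fin n) =>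
        (t ^ n)⁻¹ * (moll 1 ∘ fun z => t⁻¹ • z) z := funext fun z => moll_eq_smul ht z
    rw [UltraWeak.dd, h3, h2.fderiv]
    simp
  have hint : ∫ z : EuclideanSpace ℝ (Fin n), (t ^ n)⁻¹ * (t⁻¹ *
      ‖fderiv ℝ (moll (n := n) 1) (t⁻¹ • z)‖) = t⁻¹ * ∫ z, ‖fderiv ℝ (moll (n := n) 1) z‖ := by
    rw [integral_const_mul, integral_const_mul,
      Measure.integral_comp_smul volume (fun z => ‖fderiv ℝ (moll (n := n) 1) z‖),
      finrank_euclideanSpace_fin, abs_of_nonneg (by positivity), smul_eq_mul,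
      inv_pow, inv_inv]
    field_simp
  have hi2 : Integrable fun z : EuclideanSpace ℝ (Fin n) => (t ^ n)⁻¹ * (t⁻¹ *
      ‖fderiv ℝ (moll (n := n) 1) (t⁻¹ • z)‖) :=
    ((hi.comp_smul (inv_ne_zero ht.ne')).const_mul _).const_mul _
  rw [hu.dd_eq_integral hU v x ht hx]
  refine (norm_integral_le_of_norm_le ((hi2.comp_sub_left x).const_mul S)
    (Filter.Eventually.of_forall fun z => ?_)).trans ?_
  · by_cases hz : z ∈ Metric.closedBall x t
    · rw [norm_mul]
      refine mul_le_mul (hS z hz) ?_ (norm_nonneg _) hS0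
      rw [hdd, norm_mul, norm_mul, Real.norm_of_nonneg (by positivity),
        Real.norm_of_nonneg (by positivity : 0 ≤ t⁻¹)]
      gcongr
      exact (ContinuousLinearMap.le_opNorm _ _).trans (mul_le_of_le_one_right (norm_nonneg _) hv)
    · rw [dd_moll_eq_zero ht v, mul_zero, norm_zero]
      · positivity
      · rwa [Metric.mem_closedBall, not_le, dist_comm, dist_eq_norm] at hz
  · rw [integral_const_mul, integral_sub_left_eq_self (fun z : EuclideanSpace ℝ (Fin n) =>
      (t ^ n)⁻¹ * (t⁻¹ * ‖fderiv ℝ (moll (n := n) 1) (t⁻¹ • z)‖)), hint, mul_comm, div_eq_inv_mul]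
    gcongr
    exact le_max_right _ _

theorem MeanValueOn.iterate_dd {u : EuclideanSpace ℝ (Fin n) → ℝ}
    {U : Set (EuclideanSpace ℝ (Fin n))} (hU : IsOpen U) (hu : MeanValueOn u U)
    (v : EuclideanSpace ℝ (Fin n)) (k : ℕ) : MeanValueOn ((UltraWeak.dd v)^[k] u) U := by
  induction k with
  | zero => exact hu
  | succ k ih =>
    rw [Function.iterate_succ_apply']
    exact ih.dd hU v

/-- Analytic bounds on the Taylor coefficients of functions with the mean value property. -/
theorem exists_norm_iterate_dd_le (n : ℕ) : ∃ C : ℝ, 1 ≤ C ∧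
    ∀ (u : EuclideanSpace ℝ (Fin n) → ℝ) (U : Set (EuclideanSpace ℝ (Fin n))), IsOpen U →
      MeanValueOn u U → ∀ (v x : EuclideanSpace ℝ (Fin n)) (R S : ℝ), ‖v‖ ≤ 1 → 0 < R →
        Metric.closedBall x R ⊆ U → (∀ y ∈ Metric.closedBall x R, ‖u y‖ ≤ S) →
          ∀ k : ℕ, ‖(dd v)^[k] u x‖ / k.factorial ≤ (C / R) ^ k * S := by
  obtain ⟨C, hC1, hC⟩ := exists_norm_dd_le n
  -- Taking `k` derivatives over nested balls with step `R / k` costs `(C k / R) ^ k`; the factor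
  -- `e` comes from `k ^ k ≤ k! e ^ k`.
  refine ⟨C * Real.exp 1, one_le_mul_of_one_le_of_one_le hC1 (Real.one_le_exp zero_le_one), ?_⟩
  intro u U hU hu v x R S hv hR hx hS k
  have hS0 : 0 ≤ S := (norm_nonneg _).trans (hS x (Metric.mem_closedBall_self hR.le))
  have step : ∀ h : ℝ, 0 < h → ∀ (j : ℕ) (x : EuclideanSpace ℝ (Fin n)),
      Metric.closedBall x (j * h) ⊆ U → (∀ y ∈ Metric.closedBall x (j * h), ‖u y‖ ≤ S) →
        ‖(dd v)^[j] u x‖ ≤ (C / h) ^ j * S := by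
    intro h hh j
    induction j with
    | zero =>
      intro x _ hS
      simpa using hS x (by simp)
    | succ j ih =>
      intro x hxU hxS
      rw [Function.iterate_succ_apply', pow_succ', mul_assoc]
      have hsub : ∀ y ∈ Metric.closedBall x h,
          Metric.closedBall y (j * h) ⊆ Metric.closedBall x ((j + 1 : ℕ) * h) := fun y hy =>
        Metric.closedBall_subset_closedBall' (by
          have := Metric.mem_closedBall.1 hy
          push_cast
          linarith)
      refine hC _ U hU (hu.iterate_dd hU v j) v x h _ hv hh ?_ fun y hy =>
        ih y ((hsub y hy).trans hxU) fun z hz => hxS z (hsub y hy hz)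
      refine (Metric.closedBall_subset_closedBall ?_).trans hxU
      push_cast
      nlinarith [(Nat.cast_nonneg j : (0 : ℝ) ≤ j)]
  rcases Nat.eq_zero_or_pos k with rfl | hk
  · simpa using hS x (Metric.mem_closedBall_self hR.le)
  have hk' : (0 : ℝ) < k := Nat.cast_pos.2 hk
  have hkR : (k : ℝ) * (R / k) = R := by field_simp
  have h1 := step (R / k) (by positivity) k x (by rwa [hkR]) (by rwa [hkR])
  have h2 : (k : ℝ) ^ k / k.factorial ≤ Real.exp 1 ^ k := by
    rw [← Real.exp_nat_mul, mul_one]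
    exact Real.pow_div_factorial_le_exp _ hk'.le k
  calc ‖(dd v)^[k] u x‖ / k.factorial ≤ (C / (R / k)) ^ k * S / k.factorial := by gcongr
    _ = (C / R) ^ k * S * ((k : ℝ) ^ k / k.factorial) := by
      rw [div_div_eq_mul_div, mul_div_right_comm C, mul_pow]
      ring
    _ ≤ (C / R) ^ k * S * Real.exp 1 ^ k := by gcongr
    _ = (C * Real.exp 1 / R) ^ k * S := by
      rw [mul_div_right_comm, mul_pow]
      ring

/-! ### Taylor expansion and the three balls inequality -/

/-- Taylor's theorem for a sequence of successive derivatives. -/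
theorem norm_sub_taylor_le (N : ℕ) : ∀ (f : ℕ → ℝ → ℝ) (B T : ℝ),
    (∀ k, ∀ s ∈ Set.Icc 0 T, HasDerivAt (f k) (f (k + 1) s) s) →
    (∀ s ∈ Set.Icc 0 T, ‖f N s‖ ≤ B) → ∀ t ∈ Set.Icc 0 T,
    ‖f 0 t - ∑ k ∈ Finset.range N, f k 0 / k.factorial * t ^ k‖ ≤ B / N.factorial * t ^ N := by
  induction N with
  | zero =>
    intro f B T _ hB t ht
    simpa using hB t ht
  | succ N ih =>
    intro f B T hf hB t ht
    -- The shifted sequence bounds the derivative of the remainder, which is then compared with the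
    -- derivative of the claimed bound.
    have h1 := ih (fun k => f (k + 1)) B T (fun k => hf (k + 1)) hB
    have hder : ∀ s ∈ Set.Icc 0 T, HasDerivAt
        (fun s => f 0 s - ∑ k ∈ Finset.range (N + 1), f k 0 / k.factorial * s ^ k)
        (f 1 s - ∑ k ∈ Finset.range N, f (k + 1) 0 / k.factorial * s ^ k) s := by
      intro s hs
      refine (hf 0 s hs).sub ?_
      have h2 : HasDerivAt (fun s : ℝ => ∑ k ∈ Finset.range (N + 1), f k 0 / k.factorial * s ^ k)
          (∑ k ∈ Finset.range (N + 1), f k 0 / k.factorial * (k * s ^ (k - 1))) s :=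
        HasDerivAt.fun_sum fun k _ => (hasDerivAt_pow k s).const_mul _
      refine h2.congr_deriv ?_
      rw [Finset.sum_range_succ']
      simp only [Nat.cast_zero, zero_mul, mul_zero, add_zero, Nat.add_sub_cancel]
      refine Finset.sum_congr rfl fun k _ => ?_
      rw [Nat.factorial_succ]
      push_cast
      field_simp
    have hB' : ∀ s : ℝ, HasDerivAt (fun s => B / (N + 1).factorial * s ^ (N + 1))
        (B / N.factorial * s ^ N) s := by
      intro s
      refine ((hasDerivAt_pow (N + 1) s).const_mul _).congr_deriv ?_
      rw [Nat.factorial_succ]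
      push_cast
      field_simp
    refine image_norm_le_of_norm_deriv_right_le_deriv_boundary (a := 0) (b := T)
      (fun s hs => (hder s hs).continuousAt.continuousWithinAt)
      (fun s hs => (hder s (Set.Ico_subset_Icc_self hs)).hasDerivWithinAt) ?_
      hB' (fun s hs => h1 s (Set.Ico_subset_Icc_self hs)) ht
    rw [Finset.sum_range_succ']
    simp

theorem le_rpow_mul_rpow {a b x α : ℝ} (hx : 0 ≤ x) (hxa : x ≤ a) (hxb : x ≤ b)
    (hα : 0 < α) (hα1 : α ≤ 1) : x ≤ a ^ α * b ^ (1 - α) := by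
  calc x = x ^ α * x ^ (1 - α) := by
        rw [← Real.rpow_add_of_nonneg hx hα.le (by linarith)]
        simp
    _ ≤ a ^ α * b ^ (1 - α) := mul_le_mul (Real.rpow_le_rpow hx hxa hα.le)
        (Real.rpow_le_rpow hx hxb (by linarith)) (Real.rpow_nonneg hx _)
        (Real.rpow_nonneg (hx.trans hxa) _)

theorem sum_half_pow_le (N : ℕ) : ∑ k ∈ Finset.range N, (1 / 2 : ℝ) ^ k ≤ 2 := by
  have := Summable.sum_le_tsum (f := fun k : ℕ => (1 / 2 : ℝ) ^ k) (Finset.range N)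
    (fun _ _ => by positivity) summable_geometric_two
  rwa [tsum_geometric_two] at this

/-- A three balls inequality for functions with the mean value property. -/
theorem exists_three_balls (n : ℕ) : ∃ c : ℝ, 0 < c ∧ c ≤ 1 / 2 ∧
    ∀ r R : ℝ, 0 < r → r ≤ R → ∃ α : ℝ, 0 < α ∧ α < 1 ∧
      ∀ (u : EuclideanSpace ℝ (Fin n) → ℝ) (U : Set (EuclideanSpace ℝ (Fin n))), IsOpen U →
        MeanValueOn u U → ∀ (x : EuclideanSpace ℝ (Fin n)) (ε S : ℝ),
          Metric.closedBall x R ⊆ U → (∀ y ∈ Metric.closedBall x R, ‖u y‖ ≤ S) →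
            (∀ y ∈ Metric.closedBall x r, ‖u y‖ ≤ ε) →
              ∀ y ∈ Metric.closedBall x (c * R), ‖u y‖ ≤ 2 * (ε ^ α * S ^ (1 - α)) := by
  obtain ⟨C, hC1, hC⟩ := exists_norm_iterate_dd_le n
  have hC0 : 0 < C := one_pos.trans_le hC1
  -- This `c` makes `C t / R ≤ 1 / 4` whenever `t ≤ c R`, whatever the small radius `r` is.
  refine ⟨1 / (4 * C), by positivity, ?_, fun r R hr hrR => ?_⟩
  · rw [div_le_div_iff₀ (by positivity) (by positivity)]
    linarith
  have hR := hr.trans_le hrR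
  -- The exponent is chosen so that `(R / r) ^ α ≤ 2`; the 2 in `N + 2` keeps it below 1 even for `N
  -- = 0`.
  obtain ⟨N, hN⟩ := pow_unbounded_of_one_lt (R / r) (one_lt_two (α := ℝ))
  set α : ℝ := 1 / (N + 2) with hα
  have hα0 : 0 < α := by positivity
  have hα1 : α < 1 := by
    rw [hα, div_lt_one (by positivity)]
    linarith [(Nat.cast_nonneg N : (0 : ℝ) ≤ N)]
  have hRα : (R / r) ^ α ≤ 2 := by
    calc (R / r) ^ α ≤ ((2 : ℝ) ^ N) ^ α := Real.rpow_le_rpow (by positivity) hN.le hα0.le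
      _ = 2 ^ (N * α) := by rw [← Real.rpow_natCast, ← Real.rpow_mul (by norm_num)]
      _ ≤ 2 ^ (1 : ℝ) := by
        refine Real.rpow_le_rpow_of_exponent_le one_le_two ?_
        rw [hα, mul_one_div, div_le_one (by positivity)]
        linarith
      _ = 2 := Real.rpow_one 2
  refine ⟨α, hα0, hα1, fun u U hU hu x ε S hxU hS hε y hy => ?_⟩
  have hS0 : 0 ≤ S := (norm_nonneg _).trans (hS x (Metric.mem_closedBall_self hR.le))
  have hε0 : 0 ≤ ε := (norm_nonneg _).trans (hε x (Metric.mem_closedBall_self hr.le))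
  set t := ‖y - x‖ with ht
  have ht0 : 0 ≤ t := norm_nonneg _
  have htR : C * t / R ≤ 1 / 4 := by
    rw [Metric.mem_closedBall, dist_eq_norm, ← ht] at hy
    rw [div_le_iff₀ hR]
    calc C * t ≤ C * (1 / (4 * C) * R) := by gcongr
      _ = 1 / 4 * R := by field_simp
  -- For `y = x` this is the zero vector, which still has norm at most 1.
  set v := t⁻¹ • (y - x) with hv
  have hv1 : ‖v‖ ≤ 1 := by
    rw [hv, norm_smul, norm_inv, Real.norm_of_nonneg ht0]
    exact inv_mul_le_one
  have hyv : x + t • v = y := by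
    rcases eq_or_ne t 0 with h | h
    · rw [h, zero_smul, add_zero]
      exact (sub_eq_zero.1 (norm_eq_zero.1 h)).symm
    · rw [hv, smul_inv_smul₀ h]
      abel
  -- Interpolating the bounds from radii `r` and `R` gives the ratio `(R / r) ^ α * (C t / R) ≤ 2 *
  -- (1 / 4)`.
  have hcoef : ∀ k : ℕ, ‖(dd v)^[k] u x‖ / k.factorial * t ^ k ≤
      (1 / 2) ^ k * (ε ^ α * S ^ (1 - α)) := by
    intro k
    have h1 := hC u U hU hu v x R S hv1 hR hxU hS k
    have h2 := hC u U hU hu v x r ε hv1 hr ((Metric.closedBall_subset_closedBall hrR).trans hxU)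
      hε k
    have ha : ‖(dd v)^[k] u x‖ / k.factorial * t ^ k ≤ (C * t / r) ^ k * ε := by
      calc _ ≤ (C / r) ^ k * ε * t ^ k := by gcongr
        _ = (C * t / r) ^ k * ε := by rw [mul_div_right_comm, mul_pow]; ring
    have hb : ‖(dd v)^[k] u x‖ / k.factorial * t ^ k ≤ (C * t / R) ^ k * S := by
      calc _ ≤ (C / R) ^ k * S * t ^ k := by gcongr
        _ = (C * t / R) ^ k * S := by rw [mul_div_right_comm, mul_pow]; ring
    refine (le_rpow_mul_rpow (by positivity) ha hb hα0 hα1.le).trans ?_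
    have hq : (C * t / r) ^ α * (C * t / R) ^ (1 - α) ≤ 1 / 2 := by
      calc (C * t / r) ^ α * (C * t / R) ^ (1 - α)
          = (R / r) ^ α * ((C * t / R) ^ α * (C * t / R) ^ (1 - α)) := by
            rw [← mul_assoc, ← Real.mul_rpow (by positivity) (by positivity)]
            congr 2
            field_simp
        _ = (R / r) ^ α * (C * t / R) := by
            rw [← Real.rpow_add_of_nonneg (by positivity) hα0.le (by linarith)]
            simp
        _ ≤ 2 * (1 / 4) := by gcongr
        _ = 1 / 2 := by norm_num
    calc ((C * t / r) ^ k * ε) ^ α * ((C * t / R) ^ k * S) ^ (1 - α)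
        = ((C * t / r) ^ α * (C * t / R) ^ (1 - α)) ^ k * (ε ^ α * S ^ (1 - α)) := by
          rw [Real.mul_rpow (by positivity) hε0, Real.mul_rpow (by positivity) hS0,
            ← Real.rpow_natCast, ← Real.rpow_natCast (C * t / R), ← Real.rpow_mul (by positivity),
            ← Real.rpow_mul (by positivity), mul_comm (k : ℝ) α, mul_comm (k : ℝ) (1 - α),
            Real.rpow_mul (by positivity), Real.rpow_mul (by positivity), Real.rpow_natCast,
            Real.rpow_natCast, mul_pow]
          ring
      _ ≤ _ := by gcongr
  have hsum : ∀ K : ℕ, ‖∑ k ∈ Finset.range K, (dd v)^[k] u x / k.factorial * t ^ k‖ ≤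
      2 * (ε ^ α * S ^ (1 - α)) := by
    intro K
    calc _ ≤ ∑ k ∈ Finset.range K, ‖(dd v)^[k] u x / k.factorial * t ^ k‖ := norm_sum_le _ _
      _ = ∑ k ∈ Finset.range K, ‖(dd v)^[k] u x‖ / k.factorial * t ^ k := by
          refine Finset.sum_congr rfl fun k _ => ?_
          rw [norm_mul, norm_div, norm_pow, Real.norm_of_nonneg ht0, Real.norm_natCast]
      _ ≤ ∑ k ∈ Finset.range K, (1 / 2) ^ k * (ε ^ α * S ^ (1 - α)) :=
          Finset.sum_le_sum fun k _ => hcoef k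
      _ ≤ 2 * (ε ^ α * S ^ (1 - α)) := by
          rw [← Finset.sum_mul]
          gcongr
          exact sum_half_pow_le K
  have htR2 : t ≤ R / 2 := by
    have h1 : C * t ≤ 1 / 4 * R := (div_le_iff₀ hR).1 htR
    nlinarith
  have hball : ∀ s ∈ Set.Icc 0 t, Metric.closedBall (x + s • v) (R / 2) ⊆ Metric.closedBall x R := by
    intro s hs
    refine Metric.closedBall_subset_closedBall' ?_
    rw [dist_eq_norm, add_sub_cancel_left, norm_smul, Real.norm_of_nonneg hs.1]
    nlinarith [hs.1, hs.2, norm_nonneg v]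
  -- Balls of radius `R / 2` about the segment from `x` to `y` stay in the large ball, so the
  -- remainder is at most `(2 C t / R) ^ K * S` and tends to zero.
  have hrem : ∀ K : ℕ, ‖u y‖ ≤ 2 * (ε ^ α * S ^ (1 - α)) + (1 / 2) ^ K * S := by
    intro K
    have htay := norm_sub_taylor_le K (fun k s => (dd v)^[k] u (x + s • v))
      ((C / (R / 2)) ^ K * S * K.factorial) t ?_ ?_ t (Set.right_mem_Icc.2 ht0)
    · simp only [zero_smul, add_zero, Function.iterate_zero, id_eq] at htay
      rw [hyv] at htay
      have h1 : (C / (R / 2)) ^ K * S * K.factorial / K.factorial * t ^ K ≤ (1 / 2) ^ K * S := by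
        calc _ = (2 * (C * t / R)) ^ K * S := by
              rw [mul_div_cancel_right₀ _ (by positivity),
                show 2 * (C * t / R) = C / (R / 2) * t by field_simp, mul_pow]
              ring
          _ ≤ (1 / 2) ^ K * S := by
              gcongr
              linarith
      have h2 := norm_sub_norm_le (u y)
        (∑ k ∈ Finset.range K, (dd v)^[k] u x / k.factorial * t ^ k)
      linarith [hsum K]
    · intro k s hs
      have hmem : x + s • v ∈ U :=
        hxU (hball s hs (Metric.mem_closedBall_self (by positivity)))
      have hdiff : DifferentiableAt ℝ ((dd v)^[k] u) (x + s • v) :=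
        ((hu.iterate_dd hU v k).contDiffOn.differentiableOn (by simp)).differentiableAt
          (hU.mem_nhds hmem)
      rw [Function.iterate_succ_apply']
      have hline : HasDerivAt (fun s : ℝ => x + s • v) v s := by
        simpa using ((hasDerivAt_id s).smul_const v).const_add x
      exact hdiff.hasFDerivAt.comp_hasDerivAt s hline
    · intro s hs
      have h1 := hC u U hU hu v (x + s • v) (R / 2) S hv1 (half_pos hR) ((hball s hs).trans hxU)
        (fun z hz => hS z (hball s hs hz)) K
      exact (div_le_iff₀ (by positivity)).1 h1
  have hlim : Filter.Tendsto (fun K : ℕ => 2 * (ε ^ α * S ^ (1 - α)) + (1 / 2 : ℝ) ^ K * S)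
      Filter.atTop (nhds (2 * (ε ^ α * S ^ (1 - α)) + 0 * S)) :=
    ((tendsto_pow_atTop_nhds_zero_of_lt_one (by norm_num) (by norm_num)).mul_const S).const_add _
  rw [zero_mul, add_zero] at hlim
  exact ge_of_tendsto' hlim hrem

end MeanValue

/-! ### Propagation of smallness through a connected domain -/

section Smallness

variable {n : ℕ}

theorem lap_eq_zero_of_notMem {φ : EuclideanSpace ℝ (Fin n) → ℝ}
    {U : Set (EuclideanSpace ℝ (Fin n))} (hφ : tsupport φ ⊆ U) {x : EuclideanSpace ℝ (Fin n)}
    (hx : x ∉ U) : lap φ x = 0 := by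
  refine Finset.sum_eq_zero fun i _ => image_eq_zero_of_notMem_tsupport fun h => hx (hφ ?_)
  exact tsupport_dd_subset _ _ (tsupport_dd_subset _ _ h)

theorem integral_indicator_mul_lap {w f φ : EuclideanSpace ℝ (Fin n) → ℝ}
    {U : Set (EuclideanSpace ℝ (Fin n))} (hU : IsOpen U) (hwf : w =ᵐ[volume.restrict U] f)
    (hφ : tsupport φ ⊆ U) : ∫ y, U.indicator w y * lap φ y = ∫ y, f y * lap φ y := by
  refine integral_congr_ae ?_
  rw [Filter.EventuallyEq, ae_restrict_iff' hU.measurableSet] at hwf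
  filter_upwards [hwf] with y hy
  by_cases hyU : y ∈ U
  · rw [Set.indicator_of_mem hyU, hy hyU]
  · rw [lap_eq_zero_of_notMem hφ hyU, mul_zero, mul_zero]

/-- A classically harmonic function is weakly harmonic. -/
theorem weaklyHarmonicOn_of_harmonicOnNhd {w f : EuclideanSpace ℝ (Fin n) → ℝ}
    {U : Set (EuclideanSpace ℝ (Fin n))} (hU : IsOpen U) (hwf : w =ᵐ[volume.restrict U] f)
    (hf : InnerProductSpace.HarmonicOnNhd f U) : WeaklyHarmonicOn (U.indicator w) U := by
  intro φ hφ hφc hφU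
  rw [integral_indicator_mul_lap hU hwf hφU]
  have hf2 : ContDiffOn ℝ 2 f U := hf.contDiffOn
  have hdf : ∀ v, ContDiffOn ℝ 1 (dd v f) U := fun v =>
    (hf2.fderiv_of_isOpen hU (m := 1) (by norm_num)).clm_apply contDiffOn_const
  have hddf : ∀ v, ContinuousOn (dd v (dd v f)) U := fun v =>
    ((hdf v).continuousOn_fderiv_of_isOpen hU (by simp)).clm_apply continuousOn_const
  have hsub : ∀ v, tsupport (dd v φ) ⊆ U := fun v => (tsupport_dd_subset φ v).trans hφU
  have hparts : ∀ v, ∫ y, f y * dd v (dd v φ) y = ∫ y, dd v (dd v f) y * φ y := fun v => by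
    rw [integral_mul_dd hU (hf2.of_le (by norm_num)) (contDiff_dd hφ v) (hasCompactSupport_dd hφc v)
      (hsub v), integral_mul_dd hU (hdf v) hφ hφc hφU, neg_neg]
  calc ∫ y, f y * lap φ y
      = ∑ i, ∫ y, f y * dd (basisVec i) (dd (basisVec i) φ) y := by
        simp only [lap, Finset.mul_sum]
        refine integral_finsetSum _ fun i _ => integrable_mul_of_tsupport_subset hU hf2.continuousOn
          (contDiff_dd (contDiff_dd hφ _) _).continuous
          (hasCompactSupport_dd (hasCompactSupport_dd hφc _) _)
          ((tsupport_dd_subset _ _).trans (hsub _))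
    _ = ∫ y, lap f y * φ y := by
        simp only [hparts, lap, Finset.sum_mul]
        exact (integral_finsetSum _ fun i _ => integrable_mul_of_tsupport_subset hU (hddf _)
          hφ.continuous hφc hφU).symm
    _ = ∫ _, (0 : ℝ) := by
        congr 1
        funext y
        by_cases hy : y ∈ U
        · rw [← laplacian_eq_lap (hf y hy).1, (hf y hy).2.self_of_nhds]
          simp
        · rw [image_eq_zero_of_notMem_tsupport fun h => hy (hφU h), mul_zero]
    _ = 0 := integral_zero _ _

theorem integrable_indicator_L2 {Ω : Opens (EuclideanSpace ℝ (Fin n))}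
    (hΩb : Bornology.IsBounded (Ω : Set (EuclideanSpace ℝ (Fin n)))) (w : L2 Ω) :
    Integrable ((Ω : Set (EuclideanSpace ℝ (Fin n))).indicator w) := by
  have : IsFiniteMeasure (volume.restrict (Ω : Set (EuclideanSpace ℝ (Fin n)))) :=
    isFiniteMeasure_restrict.2 hΩb.measure_lt_top.ne
  rw [integrable_indicator_iff Ω.isOpen.measurableSet]
  exact (Lp.memLp w).integrable one_le_two

/-- Passing through weak harmonicity lets the mollifier argument of Weyl's lemma also serve
classical harmonic functions. -/
theorem IsHarmonic.exists_meanValueOn {Ω : Opens (EuclideanSpace ℝ (Fin n))}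
    (hΩb : Bornology.IsBounded (Ω : Set (EuclideanSpace ℝ (Fin n)))) {w : L2 Ω}
    (hw : IsHarmonic Ω w) : ∃ u, MeanValueOn u (Ω : Set (EuclideanSpace ℝ (Fin n))) ∧
      w =ᵐ[volume.restrict (Ω : Set (EuclideanSpace ℝ (Fin n)))] u := by
  obtain ⟨f, hf, hwf⟩ := hw
  obtain ⟨u, hu, -, hwu⟩ := (weaklyHarmonicOn_of_harmonicOnNhd Ω.isOpen hwf hf).exists_ae_eq
    Ω.isOpen (integrable_indicator_L2 hΩb w)
  exact ⟨u, hu, (indicator_ae_eq_restrict Ω.isOpen.measurableSet).symm.trans hwu⟩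

theorem norm_restrictL2_le {U V : Opens (EuclideanSpace ℝ (Fin n))} (h : V ≤ U) (z : L2 U) :
    ‖restrictL2 h z‖ ≤ ‖z‖ := by
  have h1 := (restrictL2 h).le_of_opNorm_le (LinearMap.mkContinuous_norm_le _ zero_le_one _) z
  rwa [one_mul] at h1

/-- Interior sup bound by the `L₂` norm. -/
theorem exists_norm_le_mul_norm_restrictL2 {Ω V : Opens (EuclideanSpace ℝ (Fin n))} (hV : V ≤ Ω)
    (hΩb : Bornology.IsBounded (Ω : Set (EuclideanSpace ℝ (Fin n)))) {t : ℝ} (ht : 0 < t) :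
    ∃ C : ℝ, 0 ≤ C ∧ ∀ (w : L2 Ω) (u : EuclideanSpace ℝ (Fin n) → ℝ),
      MeanValueOn u (Ω : Set (EuclideanSpace ℝ (Fin n))) →
      w =ᵐ[volume.restrict (Ω : Set (EuclideanSpace ℝ (Fin n)))] u →
        ∀ x, Metric.closedBall x t ⊆ (V : Set (EuclideanSpace ℝ (Fin n))) →
          ‖u x‖ ≤ C * ‖restrictL2 hV w‖ := by
  have hVfin : IsFiniteMeasure (volume.restrict (V : Set (EuclideanSpace ℝ (Fin n)))) :=
    isFiniteMeasure_restrict.2 (hΩb.subset hV).measure_lt_top.ne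
  have hm := mass_pos (n := n)
  refine ⟨(measureUnivNNReal (volume.restrict (V : Set (EuclideanSpace ℝ (Fin n)))) : ℝ) ^ (2 : ℝ)⁻¹ *
    ((mass n)⁻¹ * (t ^ n)⁻¹), by positivity, fun w u hu hwu x hx => ?_⟩
  have hg : Continuous fun y => moll t (x - y) :=
    (contDiff_moll t).continuous.comp (continuous_const.sub continuous_id)
  have hgm : MemLp (fun y => moll t (x - y)) 2
      (volume.restrict (V : Set (EuclideanSpace ℝ (Fin n)))) :=
    MemLp.of_bound hg.aestronglyMeasurable _
      (Filter.Eventually.of_forall fun y => norm_moll_le ht (x - y))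
  -- The mean value is an `L₂(V)` pairing with the mollifier, so Cauchy–Schwarz gives the bound.
  have h1 : u x = inner ℝ (hgm.toLp _) (restrictL2 hV w) := by
    rw [hu.eq_integral x t ht (hx.trans hV), L2.inner_def,
      ← setIntegral_eq_integral_of_forall_compl_eq_zero
        (s := (V : Set (EuclideanSpace ℝ (Fin n))))]
    · refine integral_congr_ae ?_
      filter_upwards [hgm.coeFn_toLp, restrictL2_ae_eq hV w,
        ae_mono (Measure.restrict_mono_set volume hV) hwu] with y h1 h2 h3
      rw [h1, h2, h3]
      simp
    · intro y hy
      rw [moll_eq_zero ht, mul_zero]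
      rw [← dist_eq_norm, dist_comm]
      by_contra hlt
      exact hy (hx (Metric.mem_closedBall.2 (not_le.1 hlt).le))
  rw [h1]
  refine (norm_inner_le_norm _ _).trans ?_
  gcongr
  have h2 : ∀ᵐ y ∂volume.restrict (V : Set (EuclideanSpace ℝ (Fin n))),
      ‖hgm.toLp _ y‖ ≤ (mass n)⁻¹ * (t ^ n)⁻¹ := by
    filter_upwards [hgm.coeFn_toLp] with y hy
    rw [hy]
    exact norm_moll_le ht _
  simpa using Lp.norm_le_of_ae_bound (by positivity) h2

/-- Serves to lower exponents to a common minimum when finitely many sets are united, with `a` the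
norm on `ω` and `b` the norm on `Ω`. -/
theorem rpow_mul_rpow_le_of_exponent_le {a b α β : ℝ} (ha : 0 ≤ a) (hab : a ≤ b) (hα : 0 ≤ α)
    (hαβ : α ≤ β) (hβ : β ≤ 1) : a ^ β * b ^ (1 - β) ≤ a ^ α * b ^ (1 - α) := by
  have hb := ha.trans hab
  calc a ^ β * b ^ (1 - β) = a ^ α * a ^ (β - α) * b ^ (1 - β) := by
        rw [← Real.rpow_add_of_nonneg ha hα (by linarith)]
        simp
    _ ≤ a ^ α * b ^ (β - α) * b ^ (1 - β) := by
        gcongr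
    _ = a ^ α * b ^ (1 - α) := by
        rw [mul_assoc, ← Real.rpow_add_of_nonneg hb (by linarith) (by linarith)]
        congr 2
        ring

/-- Smallness on `ω` propagates to the set `s` in the sup norm. -/
def PropagatesTo {Ω ω : Opens (EuclideanSpace ℝ (Fin n))} (hω : ω ≤ Ω)
    (s : Set (EuclideanSpace ℝ (Fin n))) : Prop :=
  ∃ α M : ℝ, 0 < α ∧ α < 1 ∧ 0 ≤ M ∧ ∀ (w : L2 Ω) (u : EuclideanSpace ℝ (Fin n) → ℝ),
    MeanValueOn u (Ω : Set (EuclideanSpace ℝ (Fin n))) →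
    w =ᵐ[volume.restrict (Ω : Set (EuclideanSpace ℝ (Fin n)))] u →
      ∀ x ∈ s, ‖u x‖ ≤ M * (‖restrictL2 hω w‖ ^ α * ‖w‖ ^ (1 - α))

section Propagation

variable {Ω ω : Opens (EuclideanSpace ℝ (Fin n))} {hω : ω ≤ Ω}

theorem PropagatesTo.mono {s t : Set (EuclideanSpace ℝ (Fin n))} (hst : s ⊆ t)
    (h : PropagatesTo hω t) : PropagatesTo hω s := by
  obtain ⟨α, M, h0, h1, hM, H⟩ := h
  exact ⟨α, M, h0, h1, hM, fun w u hu hwu x hx => H w u hu hwu x (hst hx)⟩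

theorem PropagatesTo.empty : PropagatesTo hω ∅ :=
  ⟨1 / 2, 0, by norm_num, by norm_num, le_rfl, fun _ _ _ _ _ hx => hx.elim⟩

theorem PropagatesTo.union {s t : Set (EuclideanSpace ℝ (Fin n))} (hs : PropagatesTo hω s)
    (ht : PropagatesTo hω t) : PropagatesTo hω (s ∪ t) := by
  obtain ⟨α, M, hα0, hα1, hM, H⟩ := hs
  obtain ⟨β, N, hβ0, hβ1, hN, K⟩ := ht
  refine ⟨min α β, max M N, lt_min hα0 hβ0, (min_le_left _ _).trans_lt hα1,
    hM.trans (le_max_left _ _), fun w u hu hwu x hx => ?_⟩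
  have hr := norm_restrictL2_le hω w
  rcases hx with hx | hx
  · refine (H w u hu hwu x hx).trans (mul_le_mul (le_max_left _ _) ?_ (by positivity)
      (hM.trans (le_max_left _ _)))
    exact rpow_mul_rpow_le_of_exponent_le (norm_nonneg _) hr (lt_min hα0 hβ0).le
      (min_le_left _ _) hα1.le
  · refine (K w u hu hwu x hx).trans (mul_le_mul (le_max_right _ _) ?_ (by positivity)
      (hM.trans (le_max_left _ _)))
    exact rpow_mul_rpow_le_of_exponent_le (norm_nonneg _) hr (lt_min hα0 hβ0).le
      (min_le_right _ _) hβ1.le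

/-- The norm on `ω` alone bounds the sup here and is at most `‖w‖`, so the exponent 1/2 is an
arbitrary choice. -/
theorem PropagatesTo.closedBall_of_subset
    (hΩb : Bornology.IsBounded (Ω : Set (EuclideanSpace ℝ (Fin n))))
    {x : EuclideanSpace ℝ (Fin n)} {t : ℝ} (ht : 0 < t)
    (hx : Metric.closedBall x (2 * t) ⊆ (ω : Set (EuclideanSpace ℝ (Fin n)))) :
    PropagatesTo hω (Metric.closedBall x t) := by
  obtain ⟨C, hC0, hC⟩ := exists_norm_le_mul_norm_restrictL2 hω hΩb ht
  refine ⟨1 / 2, C, by norm_num, by norm_num, hC0, fun w u hu hwu y hy => ?_⟩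
  refine (hC w u hu hwu y ((Metric.closedBall_subset_closedBall' ?_).trans hx)).trans ?_
  · have := Metric.mem_closedBall.1 hy
    linarith
  · gcongr
    exact le_rpow_mul_rpow (norm_nonneg _) le_rfl (norm_restrictL2_le hω w) (by norm_num)
      (by norm_num)

/-- Inserting one propagation bound into the three balls inequality multiplies the exponents. The
room `2 * R` lets the `L₂` norm bound `u` on the ball of radius `R`. -/
theorem exists_propagatesTo_closedBall (n : ℕ) : ∃ c : ℝ, 0 < c ∧ c ≤ 1 / 2 ∧
    ∀ {Ω ω : Opens (EuclideanSpace ℝ (Fin n))} {hω : ω ≤ Ω},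
      Bornology.IsBounded (Ω : Set (EuclideanSpace ℝ (Fin n))) →
      ∀ (x : EuclideanSpace ℝ (Fin n)) (r R : ℝ), 0 < r → r ≤ R →
        Metric.closedBall x (2 * R) ⊆ (Ω : Set (EuclideanSpace ℝ (Fin n))) →
        PropagatesTo hω (Metric.closedBall x r) →
          PropagatesTo hω (Metric.closedBall x (c * R)) := by
  obtain ⟨c, hc0, hc1, hc⟩ := exists_three_balls n
  refine ⟨c, hc0, hc1, ?_⟩
  intro Ω ω hω hΩb x r R hr hrR hxΩ ⟨β, M, hβ0, hβ1, hM, H⟩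
  obtain ⟨α, hα0, hα1, hα⟩ := hc r R hr hrR
  have hR := hr.trans_le hrR
  obtain ⟨C, hC0, hC⟩ := exists_norm_le_mul_norm_restrictL2 (le_refl Ω) hΩb hR
  refine ⟨α * β, 2 * (M ^ α * C ^ (1 - α)), mul_pos hα0 hβ0,
    mul_lt_one_of_nonneg_of_lt_one_left hα0.le hα1 hβ1.le, by positivity,
    fun w u hu hwu y hy => ?_⟩
  have hball : ∀ y ∈ Metric.closedBall x R, Metric.closedBall y R ⊆
      (Ω : Set (EuclideanSpace ℝ (Fin n))) := fun y hy =>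
    (Metric.closedBall_subset_closedBall' (by
      have := Metric.mem_closedBall.1 hy
      linarith)).trans hxΩ
  have h1 := hα u Ω Ω.isOpen hu x (M * (‖restrictL2 hω w‖ ^ β * ‖w‖ ^ (1 - β))) (C * ‖w‖)
    ((Metric.closedBall_subset_closedBall (by linarith)).trans hxΩ)
    (fun y hy => (hC w u hu hwu y (hball y hy)).trans (by
      gcongr
      exact norm_restrictL2_le _ w))
    (H w u hu hwu) y hy
  refine h1.trans (le_of_eq ?_)
  rw [Real.mul_rpow hM (by positivity), Real.mul_rpow (by positivity) (by positivity),
    Real.mul_rpow hC0 (by positivity), ← Real.rpow_mul (by positivity),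
    ← Real.rpow_mul (by positivity)]
  have h2 : ‖w‖ ^ (1 - α * β) = ‖w‖ ^ ((1 - β) * α) * ‖w‖ ^ (1 - α) := by
    rw [← Real.rpow_add_of_nonneg (norm_nonneg _)
      (mul_nonneg (by linarith) hα0.le) (by linarith)]
    congr 1
    ring
  rw [h2, mul_comm β α]
  ring

/-- Every point of a connected `Ω` has a neighbourhood to which smallness on `ω` propagates. -/
theorem exists_propagatesTo_of_mem (hω : ω ≤ Ω)
    (hΩ : IsPreconnected (Ω : Set (EuclideanSpace ℝ (Fin n))))
    (hΩb : Bornology.IsBounded (Ω : Set (EuclideanSpace ℝ (Fin n))))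
    (hne : (ω : Set (EuclideanSpace ℝ (Fin n))).Nonempty) {x : EuclideanSpace ℝ (Fin n)}
    (hx : x ∈ Ω) : ∃ r > 0, PropagatesTo hω (Metric.closedBall x r) := by
  obtain ⟨c, hc0, hc1, hc⟩ := exists_propagatesTo_closedBall n
  set A : Set (EuclideanSpace ℝ (Fin n)) :=
    {x | ∃ r > 0, PropagatesTo hω (Metric.closedBall x r)} with hA
  have hAo : IsOpen A := by
    refine Metric.isOpen_iff.2 fun x ⟨r, hr, h⟩ => ⟨r / 2, half_pos hr, fun y hy => ?_⟩
    refine ⟨r / 2, half_pos hr, h.mono (Metric.closedBall_subset_closedBall' ?_)⟩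
    have := (Metric.mem_ball.1 hy).le
    linarith
  -- Connectedness: `A` is open, meets `Ω`, and contains its limit points in `Ω`.
  refine hΩ.subset_of_closure_inter_subset hAo ?_ ?_ hx
  · obtain ⟨y, hy⟩ := hne
    obtain ⟨t, ht, hty⟩ := exists_closedBall_subset ω.isOpen hy
    refine ⟨y, hω hy, t / 2, half_pos ht, PropagatesTo.closedBall_of_subset hΩb (half_pos ht) ?_⟩
    rwa [mul_div_cancel₀ t two_ne_zero]
  · rintro y ⟨hyA, hyΩ⟩
    obtain ⟨T, hT, hTy⟩ := exists_closedBall_subset Ω.isOpen hyΩ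
    -- The ball of radius `2 * R` about a nearby `z ∈ A` stays within distance `3 * R = T` of `y`.
    -- The radius known at `z` may be tiny, but the ball of radius `c * R` reached from `z` still
    -- contains a ball about `y`.
    set R := T / 3 with hR
    have hR0 : 0 < R := by positivity
    obtain ⟨z, ⟨r, hr, hz⟩, hyz⟩ := Metric.mem_closure_iff.1 hyA (c * R / 2) (by positivity)
    have hcR : c * R ≤ R := by nlinarith
    have h1 := hc hΩb z (min r R) R (lt_min hr hR0) (min_le_right _ _)
      ((Metric.closedBall_subset_closedBall' (by
        rw [dist_comm]
        linarith)).trans hTy)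
      (hz.mono (Metric.closedBall_subset_closedBall (min_le_left _ _)))
    exact ⟨c * R / 2, by positivity, h1.mono (Metric.closedBall_subset_closedBall' (by linarith))⟩

/-- Smallness on `ω` propagates to compact subsets of a connected `Ω`. -/
theorem propagatesTo_of_isCompact (hω : ω ≤ Ω)
    (hΩ : IsPreconnected (Ω : Set (EuclideanSpace ℝ (Fin n))))
    (hΩb : Bornology.IsBounded (Ω : Set (EuclideanSpace ℝ (Fin n))))
    (hne : (ω : Set (EuclideanSpace ℝ (Fin n))).Nonempty)
    {K : Set (EuclideanSpace ℝ (Fin n))} (hK : IsCompact K)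
    (hKΩ : K ⊆ (Ω : Set (EuclideanSpace ℝ (Fin n)))) : PropagatesTo hω K := by
  refine hK.induction_on PropagatesTo.empty (fun _ _ hst h => h.mono hst)
    (fun _ _ hs ht => hs.union ht) fun x hx => ?_
  obtain ⟨r, hr, h⟩ := exists_propagatesTo_of_mem hω hΩ hΩb hne (hKΩ hx)
  exact ⟨_, mem_nhdsWithin_of_mem_nhds (Metric.closedBall_mem_nhds x hr), h⟩

end Propagation

/-- A propagation-of-smallness exponent exists. -/
theorem exists_isSmallnessExponent {Ω G ω : Opens (EuclideanSpace ℝ (Fin n))}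
    (hΩ : IsPreconnected (Ω : Set (EuclideanSpace ℝ (Fin n))))
    (hΩb : Bornology.IsBounded (Ω : Set (EuclideanSpace ℝ (Fin n))))
    (hne : (ω : Set (EuclideanSpace ℝ (Fin n))).Nonempty) (hωG : ω ≤ G) (hGΩ : G ≤ Ω)
    (hGΩc : closure (G : Set (EuclideanSpace ℝ (Fin n))) ⊆ Ω) :
    ∃ α : ℝ, 0 < α ∧ α < 1 ∧ IsSmallnessExponent hωG hGΩ α := by
  have hK : IsCompact (closure (G : Set (EuclideanSpace ℝ (Fin n)))) :=
    (hΩb.subset hGΩ).isCompact_closure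
  obtain ⟨α, M, hα0, hα1, hM, H⟩ :=
    propagatesTo_of_isCompact (hωG.trans hGΩ) hΩ hΩb hne hK hGΩc
  have hfin : IsFiniteMeasure (volume.restrict (G : Set (EuclideanSpace ℝ (Fin n)))) :=
    isFiniteMeasure_restrict.2 (hΩb.subset hGΩ).measure_lt_top.ne
  refine ⟨α, hα0, hα1, (measureUnivNNReal (volume.restrict (G : Set (EuclideanSpace ℝ (Fin n)))) : ℝ) ^
    (2 : ℝ)⁻¹ * M, fun w hw => ?_⟩
  obtain ⟨u, hu, hwu⟩ := hw.exists_meanValueOn hΩb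
  have h1 : ∀ᵐ y ∂volume.restrict (G : Set (EuclideanSpace ℝ (Fin n))),
      ‖restrictL2 hGΩ w y‖ ≤
        M * (‖restrictL2 (hωG.trans hGΩ) w‖ ^ α * ‖w‖ ^ (1 - α)) := by
    filter_upwards [restrictL2_ae_eq hGΩ w, ae_mono (Measure.restrict_mono_set volume hGΩ) hwu,
      ae_restrict_mem G.isOpen.measurableSet] with y h1 h2 h3
    rw [h1, h2]
    exact H w u hu hwu y (subset_closure h3)
  rw [mul_assoc]
  simpa using Lp.norm_le_of_ae_bound (by positivity) h1

end Smallness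

/-! ### A priori estimate for the Laplacian and conditional stability -/

section Stability

variable {n : ℕ} {U : Opens (EuclideanSpace ℝ (Fin n))}

theorem lineDerivOp_apply_eq_dd (v : EuclideanSpace ℝ (Fin n)) (φ : 𝓓(U, ℝ)) :
    ((∂_{v} φ : 𝓓(U, ℝ)) : EuclideanSpace ℝ (Fin n) → ℝ) = dd v φ := by
  funext x
  rw [dd, ← ((φ.contDiff.differentiable (by simp)) x).lineDeriv_eq_fderiv]
  exact TestFunction.lineDerivCLM_apply_of_le (by simp)

theorem lineDerivOp_comm_testFunction (v w : EuclideanSpace ℝ (Fin n)) (φ : 𝓓(U, ℝ)) :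
    (∂_{v} (∂_{w} φ) : 𝓓(U, ℝ)) = ∂_{w} (∂_{v} φ) := by
  ext x
  have h : DifferentiableAt ℝ (fderiv ℝ φ) x :=
    (φ.contDiff.fderiv_right (m := 1) (by norm_num; exact ENat.LEInfty.out)).differentiable (by norm_num) x
  have hdd : ∀ v w, dd v (dd w φ) x = fderiv ℝ (fderiv ℝ φ) x v w := by
    intro v w
    have h2 : dd v (dd w φ) x = fderiv ℝ (fun y => fderiv ℝ φ y w) x v := rfl
    rw [h2, fderiv_clm_apply h (differentiableAt_const _)]
    simp
  rw [lineDerivOp_apply_eq_dd, lineDerivOp_apply_eq_dd, lineDerivOp_apply_eq_dd,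
    lineDerivOp_apply_eq_dd, hdd, hdd]
  exact (φ.contDiff.contDiffAt.isSymmSndFDerivAt (by simp; exact ENat.LEInfty.out)) v w

theorem inner_testToL2 (u : L2 U) (φ : 𝓓(U, ℝ)) :
    inner ℝ u (testToL2 U φ) =
      ∫ x in (U : Set (EuclideanSpace ℝ (Fin n))), u x * φ x := by
  rw [L2.inner_def]
  refine integral_congr_ae ?_
  filter_upwards [testToL2_ae_eq U φ] with x hx
  rw [hx]
  simp [mul_comm]

theorem inner_testToL2_lineDerivOp (ψ φ : 𝓓(U, ℝ)) (i : Fin n) :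
    inner ℝ (testToL2 U ψ) (testToL2 U (∂_{basisVec i} φ)) =
      -inner ℝ (testToL2 U (∂_{basisVec i} ψ)) (testToL2 U φ) := by
  rw [inner_testToL2, inner_testToL2]
  exact isWeakDeriv_testToL2 U i ψ φ

theorem norm_testToL2_sq (φ : 𝓓(U, ℝ)) : ‖testToL2 U φ‖ ^ 2 = ∫ x, φ x ^ 2 := by
  rw [← real_inner_self_eq_norm_sq, inner_testToL2]
  refine Eq.trans ?_ (setIntegral_eq_integral_of_forall_compl_eq_zero
    (s := (U : Set (EuclideanSpace ℝ (Fin n)))) ?_)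
  · refine integral_congr_ae ?_
    filter_upwards [testToL2_ae_eq U φ] with x hx
    rw [hx, sq]
  · intro x hx
    rw [image_eq_zero_of_notMem_tsupport fun h => hx (φ.tsupport_subset h)]
    simp

theorem dd_coord (i : Fin n) :
    dd (basisVec i) (fun x : EuclideanSpace ℝ (Fin n) => x i) = fun _ => 1 := by
  funext x
  have h : HasFDerivAt (fun x : EuclideanSpace ℝ (Fin n) => x i)
    (EuclideanSpace.proj i : EuclideanSpace ℝ (Fin n) →L[ℝ] ℝ) x :=
    (EuclideanSpace.proj i : EuclideanSpace ℝ (Fin n) →L[ℝ] ℝ).hasFDerivAt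
  rw [dd, h.fderiv]
  simp [basisVec]

theorem dd_sq {φ : EuclideanSpace ℝ (Fin n) → ℝ} (hφ : Differentiable ℝ φ)
    (v : EuclideanSpace ℝ (Fin n)) :
    dd v (fun x => φ x ^ 2) = fun x => 2 * φ x * dd v φ x := by
  funext x
  have h : HasFDerivAt (fun x => φ x ^ 2) _ x := (hφ x).hasFDerivAt.pow 2
  rw [dd, h.fderiv]
  simp [dd]

/-- Poincaré's inequality in a coordinate direction. -/
theorem integral_sq_le_of_forall_notMem {φ : EuclideanSpace ℝ (Fin n) → ℝ} {R : ℝ}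
    (hφ : ContDiff ℝ (⊤ : ℕ∞) φ) (hφc : HasCompactSupport φ)
    (hR : ∀ x, x ∉ Metric.closedBall 0 R → φ x = 0) (i : Fin n) :
    ∫ x, φ x ^ 2 ≤ 4 * R ^ 2 * ∫ x, dd (basisVec i) φ x ^ 2 := by
  have hd : Continuous (dd (basisVec i) φ) := (contDiff_dd hφ _).continuous
  have hcs : HasCompactSupport fun x => φ x ^ 2 :=
    hφc.comp_left (g := fun y : ℝ => y ^ 2) (by simp)
  have hproj : ContDiff ℝ 1 fun x : EuclideanSpace ℝ (Fin n) => x i :=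
    (EuclideanSpace.proj i : EuclideanSpace ℝ (Fin n) →L[ℝ] ℝ).contDiff
  -- Since `∂ᵢxᵢ = 1`, the integral of `φ²` equals `-2 ∫ xᵢ φ ∂ᵢφ`. With `|xᵢ| ≤ R`, Young's
  -- inequality leaves half of it to be absorbed.
  have hparts := integral_mul_dd isOpen_univ hproj.contDiffOn (hφ.pow 2) hcs (Set.subset_univ _)
    (basisVec i)
  rw [dd_coord, dd_sq (hφ.differentiable (by simp))] at hparts
  simp only [one_mul] at hparts
  have hi1 : Integrable fun x => φ x ^ 2 := by
    have hc : Continuous fun x => φ x ^ 2 := hφ.continuous.pow 2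
    exact hc.integrable_of_hasCompactSupport hcs
  have hi2 : Integrable fun x => dd (basisVec i) φ x ^ 2 := by
    have hc : Continuous fun x => dd (basisVec i) φ x ^ 2 := hd.pow 2
    exact hc.integrable_of_hasCompactSupport
      ((hasCompactSupport_dd hφc _).comp_left (g := fun y : ℝ => y ^ 2) (by simp))
  have hi3 : Integrable fun x : EuclideanSpace ℝ (Fin n) =>
      x i * (2 * φ x * dd (basisVec i) φ x) := by
    have hc : Continuous fun x : EuclideanSpace ℝ (Fin n) =>
        x i * (2 * φ x * dd (basisVec i) φ x) :=
      hproj.continuous.mul ((continuous_const.mul hφ.continuous).mul hd)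
    refine hc.integrable_of_hasCompactSupport ?_
    exact (hasCompactSupport_dd hφc (basisVec i)).mul_left.mul_left
  have h3 : ∫ x, φ x ^ 2 ≤ ∫ x, (1 / 2 * φ x ^ 2 + 2 * R ^ 2 * dd (basisVec i) φ x ^ 2) := by
    rw [← neg_eq_iff_eq_neg.2 hparts, ← integral_neg]
    refine integral_mono hi3.neg ((hi1.const_mul _).add (hi2.const_mul _)) fun x => ?_
    change -(x i * (2 * φ x * dd (basisVec i) φ x)) ≤
      1 / 2 * φ x ^ 2 + 2 * R ^ 2 * dd (basisVec i) φ x ^ 2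
    generalize dd (basisVec i) φ x = d
    by_cases hx : x ∈ Metric.closedBall 0 R
    · have hxi : x i ^ 2 ≤ R ^ 2 := by
        have h4 : ‖x i‖ ≤ R := (PiLp.norm_apply_le x i).trans (mem_closedBall_zero_iff.1 hx)
        rw [← sq_abs]
        exact pow_le_pow_left₀ (abs_nonneg _) h4 2
      nlinarith [sq_nonneg (φ x + 2 * (x i * d)), mul_le_mul_of_nonneg_right hxi (sq_nonneg d)]
    · rw [hR x hx]
      have : 0 ≤ 2 * R ^ 2 * d ^ 2 := by positivity
      simpa using this
  rw [integral_add (hi1.const_mul _) (hi2.const_mul _), integral_const_mul,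
    integral_const_mul] at h3
  linarith

theorem norm_testToL2_sq_le {R : ℝ}
    (hR : (U : Set (EuclideanSpace ℝ (Fin n))) ⊆ Metric.closedBall 0 R) (i : Fin n)
    (φ : 𝓓(U, ℝ)) :
    ‖testToL2 U φ‖ ^ 2 ≤ 4 * R ^ 2 * ‖testToL2 U (∂_{basisVec i} φ)‖ ^ 2 := by
  rw [norm_testToL2_sq, norm_testToL2_sq, lineDerivOp_apply_eq_dd]
  exact integral_sq_le_of_forall_notMem φ.contDiff φ.hasCompactSupport
    (fun x hx => image_eq_zero_of_notMem_tsupport fun h => hx (hR (φ.tsupport_subset h))) i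

/-- Two integrations by parts and the symmetry of second derivatives turn `⟨∂ᵢ∂ᵢφ, ∂ⱼ∂ⱼφ⟩` into
`‖∂ⱼ∂ᵢφ‖²`. -/
theorem sum_norm_sq_eq_norm_sum_sq (φ : 𝓓(U, ℝ)) :
    ∑ i : Fin n, ∑ j : Fin n, ‖testToL2 U (∂_{basisVec j} (∂_{basisVec i} φ))‖ ^ 2 =
      ‖∑ i : Fin n, testToL2 U (∂_{basisVec i} (∂_{basisVec i} φ))‖ ^ 2 := by
  rw [← real_inner_self_eq_norm_sq, sum_inner]
  refine Finset.sum_congr rfl fun i _ => ?_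
  rw [inner_sum]
  refine Finset.sum_congr rfl fun j _ => ?_
  have h1 := inner_testToL2_lineDerivOp (∂_{basisVec i} (∂_{basisVec i} φ)) (∂_{basisVec j} φ) j
  have h2 := inner_testToL2_lineDerivOp (∂_{basisVec j} (∂_{basisVec i} φ)) (∂_{basisVec j} φ) i
  rw [lineDerivOp_comm_testFunction (basisVec j) (basisVec i) (∂_{basisVec i} φ), ← h2,
    lineDerivOp_comm_testFunction (basisVec i) (basisVec j) φ] at h1
  rw [← real_inner_self_eq_norm_sq, h1]

theorem norm_testToH2_sq (φ : 𝓓(U, ℝ)) :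
    ‖testToH2 U φ‖ ^ 2 = ‖testToL2 U φ‖ ^ 2 + (∑ i : Fin n, ‖testToL2 U (∂_{basisVec i} φ)‖ ^ 2 +
      ∑ i : Fin n, ∑ j : Fin n, ‖testToL2 U (∂_{basisVec j} (∂_{basisVec i} φ))‖ ^ 2) := by
  have h : ‖testToH2 U φ‖ = ‖(testToH2 U φ : L2Jet U)‖ := rfl
  rw [h, PiLp.norm_sq_eq_of_L2, Fintype.sum_sum_type, Fintype.sum_sum_type, Fintype.sum_prod_type]
  simp [testToH2]

/-- The Laplacian on all of `H²(U)`. -/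
def lapH2 (U : Opens (EuclideanSpace ℝ (Fin n))) : H2 U →L[ℝ] L2 U :=
  (∑ i : Fin n, PiLp.proj 2 (fun _ : JetIndex n => L2 U) (idx2 i i)) ∘L (H2 U).subtypeL

theorem lapH2_testToH2 (φ : 𝓓(U, ℝ)) :
    lapH2 U (testToH2 U φ) = ∑ i : Fin n, testToL2 U (∂_{basisVec i} (∂_{basisVec i} φ)) := by
  simp [lapH2, testToH2]

theorem laplacian_eq_lapH2 (v : H20 U) : laplacian U v = lapH2 U (v : H2 U) := rfl

/-- The a priori estimate `‖v‖_{H²} ≤ C ‖Δv‖_{L₂}` on `H²₀`. -/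
theorem exists_norm_le_mul_norm_laplacian (hn : 1 ≤ n)
    (hU : Bornology.IsBounded (U : Set (EuclideanSpace ℝ (Fin n)))) :
    ∃ C : ℝ, 0 ≤ C ∧ ∀ v : H20 U, ‖v‖ ≤ C * ‖laplacian U v‖ := by
  obtain ⟨R, hR⟩ := hU.subset_closedBall 0
  set K := 4 * R ^ 2
  have hK : 0 ≤ K := by positivity
  -- The summands `K * K`, `K` and 1 account for the derivatives of order zero, one and two, by
  -- Poincaré applied twice, once and not at all.
  have htest : ∀ φ : 𝓓(U, ℝ), ‖testToH2 U φ‖ ≤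
      Real.sqrt (K * K + (K + 1)) * ‖lapH2 U (testToH2 U φ)‖ := by
    intro φ
    refine le_of_sq_le_sq ?_ (by positivity)
    rw [mul_pow, Real.sq_sqrt (by positivity), norm_testToH2_sq, lapH2_testToH2,
      ← sum_norm_sq_eq_norm_sum_sq]
    set D := ∑ i : Fin n, ∑ j : Fin n, ‖testToL2 U (∂_{basisVec j} (∂_{basisVec i} φ))‖ ^ 2
    have h1 : ∑ i : Fin n, ‖testToL2 U (∂_{basisVec i} φ)‖ ^ 2 ≤ K * D := by
      rw [Finset.mul_sum]
      refine Finset.sum_le_sum fun i _ => (norm_testToL2_sq_le hR i _).trans ?_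
      gcongr
      exact Finset.single_le_sum
        (f := fun j => ‖testToL2 U (∂_{basisVec j} (∂_{basisVec i} φ))‖ ^ 2)
        (fun _ _ => by positivity) (Finset.mem_univ i)
    have h2 : ‖testToL2 U φ‖ ^ 2 ≤ K * (K * D) := by
      refine (norm_testToL2_sq_le hR ⟨0, hn⟩ φ).trans ?_
      gcongr
      exact (Finset.single_le_sum (f := fun i => ‖testToL2 U (∂_{basisVec i} φ)‖ ^ 2)
        (fun _ _ => by positivity) (Finset.mem_univ _)).trans h1
    linarith
  refine ⟨Real.sqrt (K * K + (K + 1)), Real.sqrt_nonneg _, fun v => ?_⟩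
  -- Both sides are continuous on `H²`, so the estimate passes from test functions to their closure.
  have hclosed : IsClosed {J : H2 U | ‖J‖ ≤ Real.sqrt (K * K + (K + 1)) * ‖lapH2 U J‖} :=
    isClosed_le continuous_norm (continuous_const.mul (lapH2 U).continuous.norm)
  exact closure_minimal (s := (LinearMap.range (testToH2 U) : Set (H2 U)))
    (by rintro _ ⟨φ, rfl⟩; exact htest φ) hclosed v.2

/-- Functions orthogonal to the range of the Laplacian on `H²₀` are harmonic. -/
theorem isHarmonic_of_inner_laplacian_eq_zero
    (hU : Bornology.IsBounded (U : Set (EuclideanSpace ℝ (Fin n)))) {h : L2 U}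
    (hh : ∀ v : H20 U, inner ℝ h (laplacian U v) = 0) : IsHarmonic U h := by
  have hw : WeaklyHarmonicOn ((U : Set (EuclideanSpace ℝ (Fin n))).indicator h) U := by
    intro φ hφ hφc hφU
    set ψ : 𝓓(U, ℝ) := ⟨φ, hφ, hφc, hφU⟩
    have hψ : testToH2 U ψ ∈ H20 U :=
      Submodule.le_topologicalClosure _ (LinearMap.mem_range_self _ ψ)
    have h1 := hh ⟨testToH2 U ψ, hψ⟩
    rw [laplacian_eq_lapH2, lapH2_testToH2, inner_sum] at h1
    simp only [inner_testToL2] at h1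
    rw [← integral_finsetSum _ fun i _ => integrable_mul_testFunction U h _,
      ← integral_indicator U.isOpen.measurableSet] at h1
    rw [← h1]
    congr 1
    funext y
    by_cases hy : y ∈ (U : Set (EuclideanSpace ℝ (Fin n)))
    · rw [Set.indicator_of_mem hy, Set.indicator_of_mem hy, lap, Finset.mul_sum]
      simp only [lineDerivOp_apply_eq_dd]
      rfl
    · rw [Set.indicator_of_notMem hy, Set.indicator_of_notMem hy, zero_mul]
  obtain ⟨u, -, hu, hhu⟩ := hw.exists_ae_eq U.isOpen (integrable_indicator_L2 hU h)
  exact ⟨u, hu, (indicator_ae_eq_restrict U.isOpen.measurableSet).symm.trans hhu⟩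

/-- Every `z ∈ L₂` is harmonic up to an error bounded by `‖Bz‖`. -/
theorem exists_norm_sub_le_opB (hn : 1 ≤ n)
    (hU : Bornology.IsBounded (U : Set (EuclideanSpace ℝ (Fin n)))) :
    ∃ C : ℝ, 0 ≤ C ∧ ∀ z : L2 U, ∃ h : L2 U, IsHarmonic U h ∧ ‖z - h‖ ≤ C * ‖opB U z‖ := by
  obtain ⟨C, hC0, hC⟩ := exists_norm_le_mul_norm_laplacian hn hU
  refine ⟨C, hC0, fun z => ?_⟩
  -- Projecting onto the closure avoids proving that the range is closed.
  set S : Submodule ℝ (L2 U) := (LinearMap.range (laplacian U).toLinearMap).topologicalClosure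
  set e := S.starProjection z with he
  have heS : e ∈ S := S.starProjection_apply_mem z
  have hperp : ∀ y ∈ S, inner ℝ (z - e) y = 0 := fun y hy =>
    S.starProjection_inner_eq_zero z y hy
  refine ⟨z - e, isHarmonic_of_inner_laplacian_eq_zero hU fun v =>
    hperp _ (Submodule.le_topologicalClosure _ (LinearMap.mem_range_self _ v)), ?_⟩
  rw [sub_sub_cancel]
  have hclosed : IsClosed {y : L2 U | inner ℝ z y ≤ C * ‖opB U z‖ * ‖y‖} :=
    isClosed_le (continuous_const.inner continuous_id) (continuous_const.mul continuous_norm)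
  -- On the range, `⟨z, Δv⟩ = -(Bz)(v)` is at most `‖Bz‖ ‖v‖`, and the a priori estimate replaces
  -- `‖v‖` by `C ‖Δv‖`. At `e` the left side is `‖e‖²`.
  have hbound : inner ℝ z e ≤ C * ‖opB U z‖ * ‖e‖ := by
    refine closure_minimal (s := (LinearMap.range (laplacian U).toLinearMap : Set (L2 U)))
      ?_ hclosed heS
    rintro _ ⟨v, rfl⟩
    have h1 : inner ℝ z (laplacian U v) = -opB U z v := by
      have : opB U z v = -inner ℝ z (laplacian U v) := rfl
      rw [this, neg_neg]
    calc inner ℝ z (laplacian U v) = -opB U z v := h1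
      _ ≤ ‖opB U z v‖ := neg_le_abs _
      _ ≤ ‖opB U z‖ * ‖v‖ := (opB U z).le_opNorm v
      _ ≤ ‖opB U z‖ * (C * ‖laplacian U v‖) := by
        gcongr
        exact hC v
      _ = C * ‖opB U z‖ * ‖laplacian U v‖ := by ring
  have h2 := hperp e heS
  rw [inner_sub_left, real_inner_self_eq_norm_sq] at h2
  rcases (norm_nonneg e).eq_or_lt' with h0 | h0
  · rw [h0]
    positivity
  · refine le_of_mul_le_mul_right ?_ h0
    nlinarith

theorem norm_opA_sq {Ω V : Opens (EuclideanSpace ℝ (Fin n))} (h : V ≤ Ω) (z : L2 Ω) :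
    ‖opA h z‖ ^ 2 = ‖opB Ω z‖ ^ 2 + ‖restrictL2 h z‖ ^ 2 :=
  WithLp.prod_norm_sq_eq_of_L2 _

/-- Conditional stability for a propagation-of-smallness exponent. -/
theorem IsSmallnessExponent.exists_norm_restrictL2_le {Ω G ω : Opens (EuclideanSpace ℝ (Fin n))}
    {hωG : ω ≤ G} {hGΩ : G ≤ Ω} (hn : 1 ≤ n)
    (hΩb : Bornology.IsBounded (Ω : Set (EuclideanSpace ℝ (Fin n)))) {α : ℝ} (hα0 : 0 < α)
    (hα1 : α ≤ 1) (hα : IsSmallnessExponent hωG hGΩ α) :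
    ∃ M : ℝ, ∀ z : L2 Ω, ‖restrictL2 hGΩ z‖ ≤ M * (‖opA (hωG.trans hGΩ) z‖ ^ α *
      (‖z‖ + ‖opA (hωG.trans hGΩ) z‖) ^ (1 - α)) := by
  obtain ⟨M, hM⟩ := hα
  obtain ⟨C, hC0, hC⟩ := exists_norm_sub_le_opB hn hΩb
  -- The harmonic part is at most `(1 + C) * a` on `ω` and `(1 + C) * (‖z‖ + a)` on `Ω`; the
  -- exponents sum to 1, so one factor `1 + C` comes out. The error `C * a` gives the other term.
  -- The sign of `M` is not prescribed, hence `|M|`.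
  refine ⟨C + |M| * (1 + C), fun z => ?_⟩
  obtain ⟨h, hh, hzh⟩ := hC z
  set a := ‖opA (hωG.trans hGΩ) z‖ with ha
  have ha0 : 0 ≤ a := norm_nonneg _
  have hsq := norm_opA_sq (hωG.trans hGΩ) z
  have hB : ‖opB Ω z‖ ≤ a :=
    le_of_sq_le_sq (by rw [hsq]; nlinarith [sq_nonneg ‖restrictL2 (hωG.trans hGΩ) z‖]) ha0
  have hq : ‖restrictL2 (hωG.trans hGΩ) z‖ ≤ a :=
    le_of_sq_le_sq (by rw [hsq]; nlinarith [sq_nonneg ‖opB Ω z‖]) ha0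
  have he : ‖z - h‖ ≤ C * a := hzh.trans (by gcongr)
  have hsplit : ∀ {V : Opens (EuclideanSpace ℝ (Fin n))} (hV : V ≤ Ω) (x y : L2 Ω),
      ‖restrictL2 hV x‖ ≤ ‖restrictL2 hV y‖ + ‖x - y‖ := by
    intro V hV x y
    have h1 := norm_restrictL2_le hV (x - y)
    rw [map_sub] at h1
    linarith [norm_le_norm_add_norm_sub' (restrictL2 hV x) (restrictL2 hV y)]
  have hhω : ‖restrictL2 (hωG.trans hGΩ) h‖ ≤ (1 + C) * a := by
    have := hsplit (hωG.trans hGΩ) h z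
    rw [norm_sub_rev] at this
    linarith
  have hhΩ : ‖h‖ ≤ (1 + C) * (‖z‖ + a) := by
    have h1 := norm_le_norm_add_norm_sub' h z
    rw [norm_sub_rev] at h1
    nlinarith [norm_nonneg z]
  have h1C : 1 + C = (1 + C) ^ α * (1 + C) ^ (1 - α) := by
    rw [← Real.rpow_add (by linarith)]
    simp
  calc ‖restrictL2 hGΩ z‖ ≤ ‖restrictL2 hGΩ h‖ + ‖z - h‖ := hsplit hGΩ z h
    _ ≤ |M| * (((1 + C) * a) ^ α * ((1 + C) * (‖z‖ + a)) ^ (1 - α)) + C * a := by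
      refine add_le_add ((hM h hh).trans ?_) he
      refine mul_le_mul (le_abs_self M) ?_ (by positivity) (abs_nonneg M)
      gcongr
    _ = |M| * (1 + C) * (a ^ α * (‖z‖ + a) ^ (1 - α)) + C * a := by
      rw [Real.mul_rpow (by positivity) ha0, Real.mul_rpow (by positivity) (by positivity)]
      nth_rw 3 [h1C]
      ring
    _ ≤ |M| * (1 + C) * (a ^ α * (‖z‖ + a) ^ (1 - α)) +
        C * (a ^ α * (‖z‖ + a) ^ (1 - α)) := by
      gcongr
      exact le_rpow_mul_rpow ha0 le_rfl (by linarith [norm_nonneg z]) hα0 hα1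
    _ = _ := by ring

end Stability

end UltraWeak

end

/-- Conditional stability of unique continuation for the Poisson equation in ultra-weak form. -/
theorem theorem2p2 (n : ℕ) (hn : 1 ≤ n) (Ω G ω : Opens (EuclideanSpace ℝ (Fin n)))
    (hΩ : IsConnected (Ω : Set (EuclideanSpace ℝ (Fin n))))
    (hΩb : Bornology.IsBounded (Ω : Set (EuclideanSpace ℝ (Fin n))))
    (hG : IsConnected (G : Set (EuclideanSpace ℝ (Fin n))))
    (hω : IsConnected (ω : Set (EuclideanSpace ℝ (Fin n))))
    (hωG : ω ≤ G) (hGΩ : G ≤ Ω)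
    (hGΩc : closure (G : Set (EuclideanSpace ℝ (Fin n))) ⊆ Ω) :
    (∃ α : ℝ, 0 < α ∧ α < 1 ∧ UltraWeak.IsSmallnessExponent hωG hGΩ α) ∧
    ∀ α : ℝ, 0 < α → α ≤ 1 → UltraWeak.IsSmallnessExponent hωG hGΩ α →
      ∃ M : ℝ, ∀ z : UltraWeak.L2 Ω,
        ‖UltraWeak.restrictL2 hGΩ z‖ ≤
          M * (‖UltraWeak.opA (hωG.trans hGΩ) z‖ ^ α *
            (‖z‖ + ‖UltraWeak.opA (hωG.trans hGΩ) z‖) ^ (1 - α)) := by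
  exact ⟨UltraWeak.exists_isSmallnessExponent hΩ.isPreconnected hΩb hω.nonempty hωG hGΩ hGΩc,
    fun α hα0 hα1 hα => hα.exists_norm_restrictL2_le hn hΩb hα0 hα1⟩
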